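/- **Setting.** Let $l,m,n\ge 1$. Let $v$ be a uniformly distributed random unit vector in $\mathbb{C}^l\otimes\mathbb{C}^m\otimes\mathbb{C}^n$, let $\rho=\operatorname{Tr}_{\mathbb{C}^l}|v\rangle\langle v|$ be the induced random mixed state on $\mathbb{C}^m\otimes\mathbb{C}^n$, and let $\rho^\Gamma$ be its partial transpose, the transpose acting on $\mathbb{C}^n$ only. Let $$\mu_{lm\rho^\Gamma}=\frac1{mn}\sum_{i=1}^{mn}\delta_{\lambda_i}$$ be the empirical distribution of the eigenvalues $\lambda_1,\dots,\lambda_{mn}$ (with multiplicity) of $lm\rho^\Gamma$. **Meander polynomials.** For $q\ge1$ and $1\le k\le q$ let $M_q^{(k)}$ be the number of meanders of order $q$ with $k$ connected components, that is, the number of pairs $(\sigma_1,\sigma_2)$ of noncrossing pair-partitions of $\{1,\dots,2q\}$ for which the graph on $\{1,\dots,2q\}$, in which two points are joined when they form a block of $\sigma_1$ or of $\sigma_2$, has exactly $k$ connected components. The meander polynomial is $M_q(x)=\sum_{k=1}^{q}M_q^{(k)}x^k$. **Theorem.** Fix $l\ge1$ and let $m=m_n$ be a sequence with $m_n/n\to1$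 as $n\to\infty$. Then for every integer $q\ge1$ the (expected) $2q$-th moment of $\mu_{lm\rho^\Gamma}$ is well defined and converges to $M_q(l)$: $$\lim_{n\to\infty}\mathbb{E}\int x^{2q}\,d\mu_{lm\rho^\Gamma}(x)=\lim_{n\to\infty}\frac1{mn}\,\mathbb{E}\operatorname{Tr}\left[(lm\rho^\Gamma)^{2q}\right]=M_q(l).$$ -/

import Mathlib

open MeasureTheory Filter Topology
open scoped Matrix ComplexConjugate

noncomputable section

/-! ### Noncrossing partitions and meanders -/

/-- A partition of `[N]` is noncrossing if, whenever `a < b < c < d` with `a, c` in one block and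
`b, d` in one block, these two blocks coincide. -/
def IsNoncrossing {N : ℕ} (τ : Finpartition (Finset.univ : Finset (Fin N))) : Prop :=
  ∀ B ∈ τ.parts, ∀ B' ∈ τ.parts, ∀ a b c d : Fin N,
    a < b → b < c → c < d → a ∈ B → c ∈ B → b ∈ B' → d ∈ B' → B = B'

/-- The set `NC₂(N)` of noncrossing pair-partitions of `[N]`. -/
def NC₂ (N : ℕ) : Set (Finpartition (Finset.univ : Finset (Fin N))) :=
  {τ | IsNoncrossing τ ∧ ∀ B ∈ τ.parts, B.card = 2}

/-- The graph of the system of roads given by `σ₁` (one side of the river) and `σ₂` (the other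
side): the vertices are the bridges, and two bridges are adjacent when a road on one of the two
sides joins them. -/
def meanderGraph {N : ℕ} (σ₁ σ₂ : Finpartition (Finset.univ : Finset (Fin N))) :
    SimpleGraph (Fin N) :=
  SimpleGraph.fromRel fun i j =>
    (∃ B ∈ σ₁.parts, i ∈ B ∧ j ∈ B) ∨ (∃ B ∈ σ₂.parts, i ∈ B ∧ j ∈ B)

/-- `M_p^{(k)}`: the number of (classes of) meanders of order `p`, i.e. of pairs of noncrossing
pair-partitions of the `2p` bridges, with `k` connected components. -/
def meanderNumber (p k : ℕ) : ℕ :=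
  Set.ncard {σ : Finpartition (Finset.univ : Finset (Fin (2 * p))) ×
      Finpartition (Finset.univ : Finset (Fin (2 * p))) |
    σ.1 ∈ NC₂ (2 * p) ∧ σ.2 ∈ NC₂ (2 * p) ∧
      Nat.card (meanderGraph σ.1 σ.2).ConnectedComponent = k}

/-- The meander polynomial `M_p(x) = ∑_{k=1}^p M_p^{(k)} x^k`. -/
def meanderPolynomial (p : ℕ) : Polynomial ℝ :=
  ∑ k ∈ Finset.Icc 1 p, Polynomial.C (meanderNumber p k : ℝ) * Polynomial.X ^ k

/-! ### Random quantum states and their partial transpose -/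

/-- `ℂˡ ⊗ ℂᵐ ⊗ ℂⁿ`, in coordinates with respect to the product basis. -/
abbrev TripleSpace (l m n : ℕ) : Type := EuclideanSpace ℂ (Fin l × (Fin m × Fin n))

/-- The uniform distribution on the unit sphere of `ℂˡ ⊗ ℂᵐ ⊗ ℂⁿ`: the surface measure, divided by
its total mass. -/
def uniformUnitVector (l m n : ℕ) :
    Measure (Metric.sphere (0 : TripleSpace l m n) 1) :=
  ((volume : Measure (TripleSpace l m n)).toSphere Set.univ)⁻¹ •
    (volume : Measure (TripleSpace l m n)).toSphere

/-- The matrix of `|v⟩⟨v|`. -/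
def pureState {ι : Type*} (v : EuclideanSpace ℂ ι) : Matrix ι ι ℂ :=
  Matrix.of fun i j => v i * conj (v j)

/-- The partial trace over the first tensor factor. -/
def partialTrace {ε ι : Type*} [Fintype ε] (A : Matrix (ε × ι) (ε × ι) ℂ) : Matrix ι ι ℂ :=
  Matrix.of fun i j => ∑ z, A (z, i) (z, j)

/-- The partial transpose, with the transpose acting on the second tensor factor. -/
def partialTranspose {α β : Type*} (A : Matrix (α × β) (α × β) ℂ) : Matrix (α × β) (α × β) ℂ :=
  Matrix.of fun i j => A (i.1, j.2) (j.1, i.2)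

/-- The mixed state `ρ = Tr_{ℂˡ} |v⟩⟨v|` on `ℂᵐ ⊗ ℂⁿ`. -/
def mixedState {l m n : ℕ} (v : TripleSpace l m n) : Matrix (Fin m × Fin n) (Fin m × Fin n) ℂ :=
  partialTrace (pureState v)

/-- The rescaled partial transpose `l m ρ^Γ`. -/
def rescaledPT {l m n : ℕ} (v : TripleSpace l m n) : Matrix (Fin m × Fin n) (Fin m × Fin n) ℂ :=
  ((l : ℂ) * (m : ℂ)) • partialTranspose (mixedState v)

theorem rescaledPT_isHermitian {l m n : ℕ} (v : TripleSpace l m n) :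
    (rescaledPT v).IsHermitian := by
  ext i j
  simp [rescaledPT, partialTranspose, mixedState, partialTrace, pureState, mul_comm]

/-- The empirical eigenvalue distribution `N⁻¹ ∑ᵢ δ_{λᵢ}` of an `N × N` Hermitian matrix, the
eigenvalues being repeated according to multiplicity. -/
def empiricalDistribution {ι : Type*} [Fintype ι] [DecidableEq ι] {A : Matrix ι ι ℂ}
    (hA : A.IsHermitian) : Measure ℝ :=
  (Fintype.card ι : ENNReal)⁻¹ • ∑ i, Measure.dirac (hA.eigenvalues i)

/-- The `p`-th moment of the empirical eigenvalue distribution of `l m ρ^Γ`, as a function of the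
unit vector `v` that induces `ρ`. -/
def empiricalMoment (l m n p : ℕ) (v : Metric.sphere (0 : TripleSpace l m n) 1) : ℝ :=
  ∫ x, x ^ p ∂(empiricalDistribution (rescaledPT_isHermitian (v : TripleSpace l m n)))

end

/-! Write `γ` for the full cycle `finRotate (2 * q)` and `#` for `orbitCount`. Gaussian (Wick)
moments and homogeneity give the moments of the coordinates on the sphere, and
`integral_empiricalMoment` becomes a sum over permutations `σ` of `[2q]` of `l^#σ m^#(γσ)
n^#(γ⁻¹σ)`, divided by `∑ (lmn)^#σ ~ (lmn)^(2q)`. As `m ~ n`, the term of `σ` has order `n^(#(γσ) +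
#(γ⁻¹σ) - 2 - 2q)`.

It remains to see that this exponent is at most 0, and that it is 0 exactly for the permutations
that run along a meander, with `#σ` components. Orbit counts are treated as dimensions of spaces of
invariant functions. The dimension formula for a sum and an intersection gives the bound, and
equality forces `σ` to exchange even and odd points (`orbitCount_add_le_and_flipsParity`). Such a
`σ` is glued from two involutions `σ₁`, `σ₂`, and `#(γσ) + #(γ⁻¹σ) = #(γσ₁) + #(γσ₂)`
(`orbitCount_add_eq`). Each summand on the right is at most `q + 1`, with equality exactly for
noncrossing pairings. -/

/-! ### Gaussian moments of complex coordinates -/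

open Real in
theorem integral_pow_mul_conj_pow_mul_exp (k k' : ℕ) :
    ∫ z : ℂ, z ^ k * conj z ^ k' * (rexp (-‖z‖ ^ 2) : ℂ) =
      if k = k' then (π : ℂ) * k.factorial else 0 := by
  split_ifs with h
  · subst h
    have h1 := Complex.integral_rpow_mul_exp_neg_rpow (p := 2) (q := 2 * k) (by norm_num)
      (by have : (0 : ℝ) ≤ k := by positivity
          linarith)
    have h2 : ∀ z : ℂ, z ^ k * conj z ^ k * (rexp (-‖z‖ ^ 2) : ℂ)
        = ((‖z‖ ^ (2 * k : ℝ) * rexp (-‖z‖ ^ (2 : ℝ)) : ℝ) : ℂ) := by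
      intro z
      rw [← mul_pow, Complex.mul_conj, Complex.normSq_eq_norm_sq]
      have : ‖z‖ ^ (2 * k : ℝ) = (‖z‖ ^ 2) ^ k := by
        rw [← pow_mul, ← Real.rpow_natCast]; push_cast; rfl
      rw [this]
      push_cast
      simp
    simp_rw [h2]
    rw [integral_complex_ofReal, h1]
    have : ((2 : ℝ) * k + 2) / 2 = k + 1 := by ring
    rw [this, Real.Gamma_nat_eq_factorial]
    push_cast
    ring
  -- Rotating by `u` multiplies the integral by `u ^ (k - k')`. The angle 1 serves for all `k ≠ k'`
  -- at once, because `π` is irrational.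
  · obtain ⟨u, hu⟩ : ∃ u : Circle, (u : ℂ) ^ k * conj (u : ℂ) ^ k' ≠ 1 := by
      refine ⟨Circle.exp 1, fun hu => h ?_⟩
      rw [← Circle.coe_inv_eq_conj, ← Circle.exp_neg, ← Circle.coe_pow, ← Circle.coe_pow,
        ← Circle.coe_mul, Circle.coe_eq_one, ← Circle.exp_nsmul, ← Circle.exp_nsmul,
        ← Circle.exp_add, Circle.exp_eq_one] at hu
      obtain ⟨n, hn⟩ := hu
      have hn' : ((k - k' : ℤ) : ℝ) = n * (2 * π) := by
        rw [← hn]; simp; ring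
      by_cases h0 : n = 0
      · subst h0
        simp only [Int.cast_zero, zero_mul, Int.cast_eq_zero] at hn'
        omega
      · exfalso
        have : Irrational (((2 * n : ℤ) : ℝ) * π) := irrational_pi.intCast_mul (by omega)
        apply (irrational_iff_ne_rational _).1 this (k - k' : ℤ) 1 (by norm_num)
        rw [hn']
        push_cast
        ring
    have key := (rotation u).measurePreserving.integral_comp
      (rotation u).toHomeomorph.measurableEmbedding
      (fun z : ℂ => z ^ k * conj z ^ k' * (rexp (-‖z‖ ^ 2) : ℂ))
    have h3 : ∀ z : ℂ, (rotation u z) ^ k * conj (rotation u z) ^ k' *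
        (rexp (-‖rotation u z‖ ^ 2) : ℂ) = ((u : ℂ) ^ k * conj (u : ℂ) ^ k') *
        (z ^ k * conj z ^ k' * (rexp (-‖z‖ ^ 2) : ℂ)) := by
      intro z
      rw [LinearIsometryEquiv.norm_map, rotation_apply, map_mul]
      ring
    simp_rw [h3] at key
    rw [integral_const_mul] at key
    by_contra hne
    exact hu (mul_right_cancel₀ hne (by rw [key, one_mul]))

/-- Uniqueness of Haar measure. The value of `c` is not needed: it cancels when the moments are
normalized. -/
theorem exists_integral_euclideanSpace_eq_smul_integral_pi (ι : Type*) [Fintype ι] :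
    ∃ c : ℝ, c ≠ 0 ∧ ∀ f : EuclideanSpace ℂ ι → ℂ,
      ∫ x, f x = c • ∫ y : ι → ℂ, f (WithLp.toLp 2 y) := by
  let e : EuclideanSpace ℂ ι ≃L[ℝ] (ι → ℂ) := PiLp.continuousLinearEquiv 2 ℝ (fun _ : ι => ℂ)
  have : (Measure.map e volume).IsAddHaarMeasure := e.isAddHaarMeasure_map volume
  refine ⟨Measure.addHaarScalarFactor (Measure.map e volume) volume,
    (NNReal.coe_pos.2 (Measure.addHaarScalarFactor_pos_of_isAddHaarMeasure _ _)).ne',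
    fun f => ?_⟩
  have hc := Measure.isAddLeftInvariant_eq_smul (Measure.map e volume)
    (volume : Measure (ι → ℂ))
  rw [← NNReal.smul_def, ← integral_smul_nnreal_measure, ← hc]
  exact (e.toHomeomorph.measurableEmbedding.integral_map
    (fun y : ι → ℂ => f (WithLp.toLp 2 y))).symm

theorem integral_prod_pow_mul_conj_pow {ι : Type*} [Fintype ι] (k k' : ι → ℕ) :
    ∫ y : ι → ℂ, (∏ j, y j ^ k j * conj (y j) ^ k' j) *
        (Real.exp (-‖(WithLp.toLp 2 y : EuclideanSpace ℂ ι)‖ ^ 2) : ℂ) =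
      (Real.pi : ℂ) ^ Fintype.card ι * if k = k' then ∏ j, ((k j).factorial : ℂ) else 0 := by
  have h : ∀ y : ι → ℂ, (∏ j, y j ^ k j * conj (y j) ^ k' j) *
        (Real.exp (-‖(WithLp.toLp 2 y : EuclideanSpace ℂ ι)‖ ^ 2) : ℂ) =
      ∏ j, (y j ^ k j * conj (y j) ^ k' j * (Real.exp (-‖y j‖ ^ 2) : ℂ)) := by
    intro y
    rw [Finset.prod_mul_distrib (g := fun j => (Real.exp (-‖y j‖ ^ 2) : ℂ)),
      EuclideanSpace.norm_sq_eq, ← Finset.sum_neg_distrib, Real.exp_sum]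
    push_cast
    rfl
  simp_rw [h]
  rw [integral_fintype_prod_volume_eq_prod (𝕜 := ℂ)
    (fun j (z : ℂ) => z ^ k j * conj z ^ k' j * (Real.exp (-‖z‖ ^ 2) : ℂ))]
  simp_rw [integral_pow_mul_conj_pow_mul_exp]
  split_ifs with hk
  · subst hk
    simp [Finset.prod_mul_distrib]
  · obtain ⟨j, hj⟩ := Function.ne_iff.1 hk
    rw [mul_zero]
    exact Finset.prod_eq_zero (Finset.mem_univ j) (if_neg hj)

/-- The number of permutations `σ` with `x = y ∘ σ`. -/
theorem card_perm_comp_eq {α ι : Type*} [Fintype α] [DecidableEq α] [Fintype ι] [DecidableEq ι]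
    (x y : α → ι) :
    Fintype.card {σ : Equiv.Perm α // x = y ∘ σ} =
      if (fun j => Fintype.card {i // x i = j}) = (fun j => Fintype.card {i // y i = j}) then
        ∏ j, (Fintype.card {i // x i = j}).factorial else 0 := by
  split_ifs with h
  · have e : ∀ j, Nonempty ({i // x i = j} ≃ {i // y i = j}) := fun j =>
      Fintype.card_eq.1 (congrFun h j)
    -- `τ` matches the fibres of `x` with those of `y`. Left multiplication by `τ⁻¹` then carries
    -- the solutions to the stabilizer of `x`, of order the product of the factorials of the fibre
    -- sizes.
    let τ : Equiv.Perm α := (Equiv.sigmaFiberEquiv x).symm.trans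
      ((Equiv.sigmaCongrRight fun j => (e j).some).trans (Equiv.sigmaFiberEquiv y))
    have hτ : x = y ∘ τ := by
      funext i
      exact (((e (x i)).some ⟨i, rfl⟩).2).symm
    rw [← DomMulAct.stabilizer_card x]
    refine Fintype.card_congr ((Equiv.mulLeft τ⁻¹).subtypeEquiv fun σ => ?_)
    conv_lhs => rw [hτ]
    have : x ∘ (τ⁻¹ * σ : Equiv.Perm α) = y ∘ σ := by
      rw [hτ]; funext i; simp
    rw [Equiv.coe_mulLeft, this, hτ]
    exact eq_comm
  · rw [Fintype.card_eq_zero_iff]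
    refine ⟨fun ⟨σ, hσ⟩ => h ?_⟩
    funext j
    refine Fintype.card_congr (σ.subtypeEquiv fun i => ?_)
    rw [hσ]; rfl

open Real in
theorem exists_gaussian_moment_eq (ι : Type*) [Fintype ι] [DecidableEq ι] :
    ∃ W : ℂ, W ≠ 0 ∧ ∀ (p : ℕ) (x y : Fin p → ι),
      ∫ v : EuclideanSpace ℂ ι, (∏ i, v (x i) * conj (v (y i))) * (rexp (-‖v‖ ^ 2) : ℂ) =
        W * (Fintype.card {σ : Equiv.Perm (Fin p) // x = y ∘ σ} : ℂ) := by
  obtain ⟨c, hc, h⟩ := exists_integral_euclideanSpace_eq_smul_integral_pi ι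
  refine ⟨c * π ^ Fintype.card ι, by simp [hc, pi_ne_zero], fun p x y => ?_⟩
  rw [h]
  have h2 : ∀ w : ι → ℂ, ∏ i, w (x i) * conj (w (y i)) =
      ∏ j, w j ^ Fintype.card {i // x i = j} * conj (w j) ^ Fintype.card {i // y i = j} := by
    intro w
    rw [Finset.prod_mul_distrib, Finset.prod_mul_distrib]
    have aux : ∀ (u : ι → ℂ) (x : Fin p → ι),
        ∏ i, u (x i) = ∏ j, u j ^ Fintype.card {i // x i = j} := by
      intro u x
      rw [Finset.prod_comp u x, Finset.prod_subset (Finset.subset_univ _)]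
      · simp [Fintype.card_subtype]
      · intro j _ hj
        rw [Finset.card_eq_zero.2, pow_zero]
        ext i
        simp only [Finset.mem_image, Finset.mem_univ, true_and, not_exists] at hj
        simp [hj i]
    rw [aux, aux (fun j => conj (w j))]
  simp_rw [h2]
  rw [integral_prod_pow_mul_conj_pow, card_perm_comp_eq]
  split_ifs with hk <;> simp [mul_assoc]

/-! ### Moments on the unit sphere -/

/-- Integration in polar coordinates of a homogeneous function against a Gaussian. -/
theorem exists_integral_mul_exp_eq_integral_toSphere_mul (E : Type*) [NormedAddCommGroup E]
    [NormedSpace ℝ E] [MeasurableSpace E] [BorelSpace E] [FiniteDimensional ℝ E] [Nontrivial E]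
    (μ : Measure E) [μ.IsAddHaarMeasure] (k : ℕ) :
    ∃ R : ℂ, ∀ f : E → ℂ, (∀ (r : ℝ) (x : E), 0 < r → f (r • x) = (r : ℂ) ^ k * f x) →
      ∫ x, f x * (Real.exp (-‖x‖ ^ 2) : ℂ) ∂μ =
        (∫ s : Metric.sphere (0 : E) 1, f s ∂μ.toSphere) * R := by
  refine ⟨∫ r : Set.Ioi (0 : ℝ), ((r : ℝ) : ℂ) ^ k * (Real.exp (-(r : ℝ) ^ 2) : ℂ)
    ∂(Measure.volumeIoiPow (Module.finrank ℝ E - 1)), fun f hf => ?_⟩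
  rw [← integral_prod_mul]
  calc
    ∫ x, f x * (Real.exp (-‖x‖ ^ 2) : ℂ) ∂μ =
      ∫ x : ({(0)}ᶜ : Set E), f x * (Real.exp (-‖x.1‖ ^ 2) : ℂ) ∂(μ.comap (↑)) := by
      rw [integral_subtype_comap (measurableSet_singleton _).compl
        fun x => f x * (Real.exp (-‖x‖ ^ 2) : ℂ), restrict_compl_singleton]
    _ = _ := by
      rw [← μ.measurePreserving_homeomorphUnitSphereProd.integral_comp
        (Homeomorph.measurableEmbedding _)]
      congr 1
      funext x
      have hx : 0 < ‖(x : E)‖ := norm_pos_iff.2 x.2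
      have h := hf ‖(x : E)‖ (‖(x : E)‖⁻¹ • (x : E)) hx
      rw [smul_inv_smul₀ hx.ne'] at h
      simp only [homeomorphUnitSphereProd_apply_snd_coe, homeomorphUnitSphereProd_apply_fst_coe]
      rw [h]
      ring

/-- The number of orbits of a permutation, fixed points included. -/
noncomputable def orbitCount {X : Type*} (σ : Equiv.Perm X) : ℕ :=
  Nat.card (Quotient (Equiv.Perm.SameCycle.setoid σ))

theorem apply_eq_of_sameCycle {X D : Type*} {σ : Equiv.Perm X} {f : X → D}
    (hf : ∀ x, f (σ x) = f x) {x y : X} (h : σ.SameCycle x y) : f x = f y := by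
  obtain ⟨n, rfl⟩ := h
  induction n using Int.induction_on with
  | zero => simp
  | succ n ih => rw [add_comm, zpow_add, Equiv.Perm.mul_apply, zpow_one, hf, ih]
  | pred n ih =>
    rw [sub_eq_add_neg, add_comm, zpow_add, Equiv.Perm.mul_apply, ih, zpow_neg_one,
      ← hf (σ⁻¹ _)]
    simp

/-- Invariant functions are functions on the set of orbits. -/
noncomputable def invariantEquiv {X : Type*} (D : Type*) (σ : Equiv.Perm X) :
    {f : X → D // ∀ x, f (σ x) = f x} ≃ (Quotient (Equiv.Perm.SameCycle.setoid σ) → D) where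
  toFun f := Quotient.lift f.1 fun _ _ h => apply_eq_of_sameCycle f.2 h
  invFun g := ⟨fun x => g ⟦x⟧, fun x => congrArg g
    (Quotient.sound (Equiv.Perm.sameCycle_apply_left.2 (Equiv.Perm.SameCycle.refl σ x)))⟩
  left_inv f := rfl
  right_inv g := by
    funext a
    induction a using Quotient.inductionOn
    rfl

theorem card_invariant {X : Type*} [Finite X] (D : Type*) (σ : Equiv.Perm X) :
    Nat.card {f : X → D // ∀ x, f (σ x) = f x} = Nat.card D ^ orbitCount σ := by
  rw [Nat.card_congr (invariantEquiv D σ), Nat.card_fun, orbitCount]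

theorem card_eq_comp {X : Type*} [Finite X] (D : Type*) (σ : Equiv.Perm X) :
    Nat.card {f : X → D // f = f ∘ σ} = Nat.card D ^ orbitCount σ := by
  rw [← card_invariant D σ]
  refine Nat.card_congr (Equiv.subtypeEquivRight fun f => ?_)
  rw [funext_iff]
  exact forall_congr' fun x => eq_comm

theorem sum_card_subtype_comm {A B : Type*} [Fintype A] [Fintype B] (P : A → B → Prop) :
    ∑ a, Nat.card {b // P a b} = ∑ b, Nat.card {a // P a b} := by
  classical
  simp_rw [Nat.card_eq_fintype_card, Fintype.card_subtype, Finset.card_filter]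
  exact Finset.sum_comm

/-- Moments of the coordinates of a uniformly distributed unit vector. -/
theorem average_sphere_monomial {ι : Type*} [Fintype ι] [Nonempty ι] (p : ℕ)
    (x y : Fin p → ι) :
    ∫ v : Metric.sphere (0 : EuclideanSpace ℂ ι) 1,
        ∏ i, (v : EuclideanSpace ℂ ι) (x i) * conj ((v : EuclideanSpace ℂ ι) (y i))
        ∂(((volume : Measure (EuclideanSpace ℂ ι)).toSphere Set.univ)⁻¹ •
          (volume : Measure (EuclideanSpace ℂ ι)).toSphere) =
      (Nat.card {σ : Equiv.Perm (Fin p) // x = y ∘ σ} : ℂ) /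
        ((∑ σ : Equiv.Perm (Fin p), Fintype.card ι ^ orbitCount σ : ℕ) : ℂ) := by
  classical
  obtain ⟨W, hW, h⟩ := exists_gaussian_moment_eq ι
  obtain ⟨R, hR⟩ := exists_integral_mul_exp_eq_integral_toSphere_mul (EuclideanSpace ℂ ι)
    volume (2 * p)
  have hom : ∀ (x y : Fin p → ι) (r : ℝ) (v : EuclideanSpace ℂ ι), 0 < r →
      ∏ i, (r • v) (x i) * conj ((r • v) (y i)) = (r : ℂ) ^ (2 * p) *
        ∏ i, v (x i) * conj (v (y i)) := by
    intro x y r v _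
    have : ∀ i, (r • v) (x i) * conj ((r • v) (y i)) =
        (r : ℂ) ^ 2 * (v (x i) * conj (v (y i))) := by
      intro i
      simp only [PiLp.smul_apply, Complex.real_smul, map_mul, Complex.conj_ofReal]
      ring
    simp_rw [this, Finset.prod_mul_distrib, Finset.prod_const, Finset.card_univ,
      Fintype.card_fin, pow_mul]
  have key : ∀ x y : Fin p → ι,
      (∫ v : Metric.sphere (0 : EuclideanSpace ℂ ι) 1,
        ∏ i, (v : EuclideanSpace ℂ ι) (x i) * conj ((v : EuclideanSpace ℂ ι) (y i))
        ∂(volume : Measure (EuclideanSpace ℂ ι)).toSphere) * R =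
      W * (Nat.card {σ : Equiv.Perm (Fin p) // x = y ∘ σ} : ℂ) := by
    intro x y
    rw [Nat.card_eq_fintype_card, ← h p x y]
    exact (hR (fun v => ∏ i, v (x i) * conj (v (y i))) (hom x y)).symm
  -- Summing `key` over `x = y` and using `‖v‖ = 1` fixes the normalization, so neither the area of
  -- the sphere nor the radial integral `R` has to be computed. Both are nonzero because the right
  -- side is.
  have hZ : ((volume : Measure (EuclideanSpace ℂ ι)).toSphere.real Set.univ : ℂ) * R =
      W * ((∑ σ : Equiv.Perm (Fin p), Fintype.card ι ^ orbitCount σ : ℕ) : ℂ) := by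
    have h1 : ∀ v : Metric.sphere (0 : EuclideanSpace ℂ ι) 1,
        ∑ x : Fin p → ι, ∏ i, (v : EuclideanSpace ℂ ι) (x i) *
          conj ((v : EuclideanSpace ℂ ι) (x i)) = 1 := by
      intro v
      have := Finset.prod_univ_sum (fun _ : Fin p => (Finset.univ : Finset ι))
        (fun _ j => (v : EuclideanSpace ℂ ι) j * conj ((v : EuclideanSpace ℂ ι) j))
      rw [Fintype.piFinset_univ] at this
      rw [← this]
      refine Finset.prod_eq_one fun i _ => ?_
      have hv := EuclideanSpace.norm_sq_eq (v : EuclideanSpace ℂ ι)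
      rw [norm_eq_of_mem_sphere] at hv
      simp_rw [Complex.mul_conj, Complex.normSq_eq_norm_sq]
      rw [← Complex.ofReal_sum, ← hv]
      simp
    have h2 : ((volume : Measure (EuclideanSpace ℂ ι)).toSphere.real Set.univ : ℂ) =
        ∑ x : Fin p → ι, ∫ v : Metric.sphere (0 : EuclideanSpace ℂ ι) 1,
          ∏ i, (v : EuclideanSpace ℂ ι) (x i) * conj ((v : EuclideanSpace ℂ ι) (x i))
          ∂(volume : Measure (EuclideanSpace ℂ ι)).toSphere := by
      rw [← integral_finsetSum]
      · simp_rw [h1]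
        simp
      · intro x _
        refine Continuous.integrable_of_hasCompactSupport ?_ (HasCompactSupport.of_compactSpace _)
        fun_prop
    rw [h2, Finset.sum_mul]
    simp_rw [key]
    rw [← Finset.mul_sum, ← Nat.cast_sum, sum_card_subtype_comm]
    simp_rw [card_eq_comp, Nat.card_eq_fintype_card]
  have hZ0 : ((∑ σ : Equiv.Perm (Fin p), Fintype.card ι ^ orbitCount σ : ℕ) : ℂ) ≠ 0 := by
    rw [Nat.cast_ne_zero]
    exact (Finset.sum_pos (fun σ _ => pow_pos Fintype.card_pos _) Finset.univ_nonempty).ne'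
  have hne : ((volume : Measure (EuclideanSpace ℂ ι)).toSphere.real Set.univ : ℂ) * R ≠ 0 := by
    rw [hZ]; exact mul_ne_zero hW hZ0
  rw [integral_smul_measure, ENNReal.toReal_inv, ← measureReal_def, eq_div_iff hZ0,
    Complex.real_smul, Complex.ofReal_inv]
  have hS := left_ne_zero_of_mul hne
  have hR0 := right_ne_zero_of_mul hne
  have hxy := key x y
  rw [inv_mul_eq_div, div_mul_eq_mul_div, div_eq_iff hS]
  refine mul_right_cancel₀ hR0 ?_
  rw [mul_right_comm, hxy, mul_assoc _ _ R, hZ]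
  ring

/-! ### Trace expansion and the sum over permutations -/

/-- A sum over walks from `i` to `j`: `Fin.cons i f` lists the starting points of the steps and
`Fin.snoc f j` their end points. -/
theorem pow_succ_apply_eq_sum {ι R : Type*} [Fintype ι] [DecidableEq ι] [CommSemiring R]
    (A : Matrix ι ι R) (k : ℕ) (i j : ι) :
    (A ^ (k + 1)) i j = ∑ f : Fin k → ι, ∏ t : Fin (k + 1),
      A ((Fin.cons i f : Fin (k + 1) → ι) t) ((Fin.snoc f j : Fin (k + 1) → ι) t) := by
  induction k generalizing i with
  | zero => simp [Fin.snoc]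
  | succ k ih =>
    rw [pow_succ', Matrix.mul_apply, ← (Fin.consEquiv fun _ : Fin (k + 1) => ι).sum_comp,
      Fintype.sum_prod_type]
    refine Finset.sum_congr rfl fun x _ => ?_
    rw [ih, Finset.mul_sum]
    refine Finset.sum_congr rfl fun f _ => ?_
    have h : (Fin.snoc (Fin.cons x f : Fin (k + 1) → ι) j : Fin (k + 1 + 1) → ι) =
        Fin.cons x (Fin.snoc f j : Fin (k + 1) → ι) :=
      (Fin.cons_snoc_eq_snoc_cons (β := ι) x f j).symm
    have h' : (Fin.consEquiv fun _ : Fin (k + 1) => ι) (x, f) = Fin.cons x f := rfl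
    rw [Fin.prod_univ_succ (n := k + 1), h', h]
    simp only [Fin.cons_zero, Fin.cons_succ]

theorem trace_pow_eq_sum {ι R : Type*} [Fintype ι] [DecidableEq ι] [CommSemiring R]
    (A : Matrix ι ι R) {p : ℕ} (hp : p ≠ 0) :
    (A ^ p).trace = ∑ f : Fin p → ι, ∏ t, A (f t) (f (finRotate p t)) := by
  obtain ⟨k, rfl⟩ := Nat.exists_eq_succ_of_ne_zero hp
  rw [Matrix.trace, ← (Fin.consEquiv fun _ : Fin (k + 1) => ι).sum_comp, Fintype.sum_prod_type]
  refine Finset.sum_congr rfl fun i _ => ?_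
  rw [Matrix.diag_apply, pow_succ_apply_eq_sum]
  refine Finset.sum_congr rfl fun f _ => ?_
  rw [Fin.snoc_eq_cons_rotate]
  rfl

theorem trace_pow_eq_sum_eigenvalues {ι : Type*} [Fintype ι] [DecidableEq ι] {A : Matrix ι ι ℂ}
    (hA : A.IsHermitian) (p : ℕ) :
    (A ^ p).trace = ∑ i, (hA.eigenvalues i : ℂ) ^ p := by
  conv_lhs => rw [hA.spectral_theorem]
  rw [← map_pow, Unitary.conjStarAlgAut_apply, Matrix.trace_mul_comm, ← mul_assoc,
    Unitary.coe_star_mul_self, one_mul, Matrix.diagonal_pow, Matrix.trace_diagonal]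
  rfl

theorem ofReal_empiricalMoment (l m n p : ℕ) (v : Metric.sphere (0 : TripleSpace l m n) 1) :
    (empiricalMoment l m n p v : ℂ) =
      ((m : ℂ) * n)⁻¹ * (rescaledPT (v : TripleSpace l m n) ^ p).trace := by
  rw [trace_pow_eq_sum_eigenvalues (rescaledPT_isHermitian (v : TripleSpace l m n)),
    empiricalMoment, empiricalDistribution, integral_smul_measure,
    integral_finsetSum_measure (fun i _ => integrable_dirac (by simp))]
  simp

theorem continuous_empiricalMoment (l m n p : ℕ) : Continuous (empiricalMoment l m n p) := by
  have h : empiricalMoment l m n p = fun v : Metric.sphere (0 : TripleSpace l m n) 1 =>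
      (((m : ℂ) * n)⁻¹ * (rescaledPT (v : TripleSpace l m n) ^ p).trace).re := by
    funext v
    rw [← ofReal_empiricalMoment, Complex.ofReal_re]
  have h2 : Continuous fun v : Metric.sphere (0 : TripleSpace l m n) 1 =>
      rescaledPT (v : TripleSpace l m n) := by
    unfold rescaledPT partialTranspose mixedState partialTrace pureState
    refine continuous_matrix fun i j => ?_
    simp only [Matrix.smul_apply, Matrix.of_apply]
    fun_prop
  rw [h]
  exact Complex.continuous_re.comp (continuous_const.mul (h2.pow p).matrix_trace)

theorem integrable_empiricalMoment (l m n p : ℕ) :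
    Integrable (empiricalMoment l m n p) (uniformUnitVector l m n) := by
  -- If a dimension is 0, the total mass vanishes and its inverse is infinite; the measure is still
  -- 0.
  rcases eq_or_ne ((volume : Measure (TripleSpace l m n)).toSphere Set.univ) 0 with h | h
  · rw [uniformUnitVector, Measure.measure_univ_eq_zero.1 h, smul_zero]
    exact integrable_zero_measure
  · refine Integrable.smul_measure ?_ (ENNReal.inv_ne_top.2 h)
    exact (continuous_empiricalMoment l m n p).integrable_of_hasCompactSupport
      (HasCompactSupport.of_compactSpace _)

theorem trace_rescaledPT_pow {l m n p : ℕ} (hp : p ≠ 0) (v : TripleSpace l m n) :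
    (rescaledPT v ^ p).trace = ((l : ℂ) * m) ^ p *
      ∑ w : (Fin p → Fin m × Fin n) × (Fin p → Fin l),
        ∏ t, v (w.2 t, ((w.1 t).1, (w.1 (finRotate p t)).2)) *
          conj (v (w.2 t, ((w.1 (finRotate p t)).1, (w.1 t).2))) := by
  rw [trace_pow_eq_sum _ hp, Fintype.sum_prod_type, Finset.mul_sum]
  refine Finset.sum_congr rfl fun f _ => ?_
  simp only [rescaledPT, Matrix.smul_apply, smul_eq_mul]
  rw [Finset.prod_mul_distrib, Finset.prod_const, Finset.card_univ, Fintype.card_fin]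
  congr 1
  simp only [partialTranspose, mixedState, partialTrace, pureState, Matrix.of_apply]
  rw [Finset.prod_univ_sum, Fintype.piFinset_univ]

theorem card_comp_eq_comp {X : Type*} [Finite X] (D : Type*) (γ σ : Equiv.Perm X) :
    Nat.card {b : X → D // b ∘ γ = b ∘ σ} = Nat.card D ^ orbitCount (γ⁻¹ * σ) := by
  rw [← card_eq_comp D (γ⁻¹ * σ)]
  refine Nat.card_congr ((Equiv.arrowCongr γ⁻¹ (Equiv.refl D)).subtypeEquiv fun b => ?_)
  have h1 : Equiv.arrowCongr γ⁻¹ (Equiv.refl D) b = b ∘ γ := by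
    funext i; simp [Equiv.arrowCongr, Equiv.Perm.inv_def]
  rw [h1]
  have h2 : (b ∘ γ) ∘ (γ⁻¹ * σ : Equiv.Perm X) = b ∘ σ := by funext i; simp
  rw [h2]

/-- The three tensor factors decouple. The transpose on the last one reverses the cycle there,
whence `γ⁻¹` in place of `γ`. -/
theorem card_index_eq (l m n p : ℕ) (σ : Equiv.Perm (Fin p)) :
    Nat.card {w : (Fin p → Fin m × Fin n) × (Fin p → Fin l) //
      (fun t => (w.2 t, ((w.1 t).1, (w.1 (finRotate p t)).2))) =
        (fun t => (w.2 t, ((w.1 (finRotate p t)).1, (w.1 t).2))) ∘ σ} =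
      l ^ orbitCount σ * (m ^ orbitCount (finRotate p * σ) *
        n ^ orbitCount ((finRotate p)⁻¹ * σ)) := by
  have h1 := card_eq_comp (Fin l) σ
  have h2 := card_eq_comp (Fin m) (finRotate p * σ)
  have h3 := card_comp_eq_comp (Fin n) (finRotate p) σ
  simp only [Nat.card_eq_fintype_card (α := Fin _), Fintype.card_fin] at h1 h2 h3
  rw [← h1, ← h2, ← h3, ← Nat.card_prod, ← Nat.card_prod]
  refine Nat.card_congr
    { toFun := fun w => (⟨w.1.2, ?_⟩, ⟨fun t => (w.1.1 t).1, ?_⟩, ⟨fun t => (w.1.1 t).2, ?_⟩)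
      invFun := fun u => ⟨(fun t => (u.2.1.1 t, u.2.2.1 t), u.1.1), ?_⟩
      left_inv := fun _ => rfl
      right_inv := fun _ => rfl }
  · exact funext fun t => congrArg Prod.fst (congrFun w.2 t)
  · exact funext fun t => congrArg (fun x => x.2.1) (congrFun w.2 t)
  · exact funext fun t => congrArg (fun x => x.2.2) (congrFun w.2 t)
  · funext t
    exact Prod.ext (congrFun u.1.2 t) (Prod.ext (congrFun u.2.1.2 t) (congrFun u.2.2.2 t))

/-- The genus expansion of the expected moments. -/
theorem integral_empiricalMoment {l m n p : ℕ} (hl : l ≠ 0) (hm : m ≠ 0) (hn : n ≠ 0)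
    (hp : p ≠ 0) :
    ∫ v, empiricalMoment l m n p v ∂(uniformUnitVector l m n) =
      ((m : ℝ) * n)⁻¹ * (((l : ℝ) * m) ^ p *
        ((∑ σ : Equiv.Perm (Fin p), (l : ℝ) ^ orbitCount σ *
          ((m : ℝ) ^ orbitCount (finRotate p * σ) * (n : ℝ) ^ orbitCount ((finRotate p)⁻¹ * σ))) /
        ∑ σ : Equiv.Perm (Fin p), ((l : ℝ) * (m * n)) ^ orbitCount σ)) := by
  have : NeZero l := ⟨hl⟩
  have : NeZero m := ⟨hm⟩
  have : NeZero n := ⟨hn⟩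
  rw [← Complex.ofReal_inj, ← integral_complex_ofReal]
  simp_rw [ofReal_empiricalMoment, trace_rescaledPT_pow hp]
  rw [integral_const_mul, integral_const_mul, integral_finsetSum]
  · simp_rw [uniformUnitVector, average_sphere_monomial]
    rw [← Finset.sum_div, ← Nat.cast_sum, sum_card_subtype_comm]
    simp_rw [card_index_eq]
    simp
  · intro w _
    have hc : Continuous fun v : Metric.sphere (0 : TripleSpace l m n) 1 =>
        ∏ t, (v : TripleSpace l m n) (w.2 t, ((w.1 t).1, (w.1 (finRotate p t)).2)) *
          conj ((v : TripleSpace l m n) (w.2 t, ((w.1 (finRotate p t)).1, (w.1 t).2))) := by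
      fun_prop
    refine Integrable.smul_measure (hc.integrable_of_hasCompactSupport
      (HasCompactSupport.of_compactSpace _)) (ENNReal.inv_ne_top.2 ?_)
    rw [Ne, Measure.measure_univ_eq_zero]
    exact Measure.toSphere_ne_zero _

/-! ### The bound on the exponent -/

/-- The functions that are constant on the orbits of `σ`. -/
def invariantFunctions {X : Type*} (σ : Equiv.Perm X) : Submodule ℚ (X → ℚ) where
  carrier := {f | ∀ x, f (σ x) = f x}
  add_mem' hf hg x := by simp [hf x, hg x]
  zero_mem' x := rfl
  smul_mem' c f hf x := by simp [hf x]

theorem finrank_invariantFunctions {X : Type*} [Finite X] (σ : Equiv.Perm X) :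
    Module.finrank ℚ (invariantFunctions σ) = orbitCount σ := by
  let e : invariantFunctions σ ≃ₗ[ℚ] (Quotient (Equiv.Perm.SameCycle.setoid σ) → ℚ) :=
    { invariantEquiv ℚ σ with
      map_add' := fun f g => by
        funext a
        induction a using Quotient.inductionOn
        rfl
      map_smul' := fun c f => by
        funext a
        induction a using Quotient.inductionOn
        rfl }
  have := Fintype.ofFinite (Quotient (Equiv.Perm.SameCycle.setoid σ))
  rw [e.finrank_eq, Module.finrank_fintype_fun_eq_card, orbitCount, Nat.card_eq_fintype_card]

theorem val_finRotate {n : ℕ} (i : Fin n) :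
    (finRotate n i).val = if i.val + 1 = n then 0 else i.val + 1 := by
  obtain ⟨k, rfl⟩ : ∃ k, n = k + 1 := ⟨n - 1, by have := i.2; omega⟩
  rw [coe_finRotate]
  simp [Fin.ext_iff]

theorem val_finRotate_mod_two {q : ℕ} (i : Fin (2 * q)) :
    (finRotate (2 * q) i).val % 2 = (i.val + 1) % 2 := by
  rw [val_finRotate]
  split_ifs <;> omega

theorem val_finRotate_inv_mod_two {q : ℕ} (i : Fin (2 * q)) :
    ((finRotate (2 * q))⁻¹ i).val % 2 = (i.val + 1) % 2 := by
  have := val_finRotate_mod_two ((finRotate (2 * q))⁻¹ i)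
  rw [← Equiv.Perm.mul_apply, mul_inv_cancel, Equiv.Perm.one_apply] at this
  omega

/-- A permutation of `[2q]` that exchanges even and odd points. -/
def FlipsParity {N : ℕ} (σ : Equiv.Perm (Fin N)) : Prop :=
  ∀ i, (σ i).val % 2 = (i.val + 1) % 2

theorem finrank_invariantFunctions_finRotate_sq_le (q : ℕ) (hq : 1 ≤ q) :
    Module.finrank ℚ (invariantFunctions (finRotate (2 * q) * finRotate (2 * q))) ≤ 2 := by
  let i₀ : Fin (2 * q) := ⟨0, by omega⟩
  let i₁ : Fin (2 * q) := ⟨1, by omega⟩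
  let φ : (Fin (2 * q) → ℚ) →ₗ[ℚ] ℚ × ℚ := (LinearMap.proj i₀).prod (LinearMap.proj i₁)
  have hinj : Function.Injective
      (φ.domRestrict (invariantFunctions (finRotate (2 * q) * finRotate (2 * q)))) := by
    rw [← LinearMap.ker_eq_bot, LinearMap.ker_eq_bot']
    rintro ⟨f, hf⟩ h
    have h0 : f i₀ = 0 := congrArg Prod.fst h
    have h1 : f i₁ = 0 := congrArg Prod.snd h
    have key : ∀ k (hk : k < 2 * q), f ⟨k, hk⟩ = 0 := by
      intro k
      induction k using Nat.strong_induction_on with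
      | _ k ih =>
        intro hk
        rcases k with _ | _ | k
        · exact h0
        · exact h1
        · rw [← ih k (by omega) (by omega), ← hf ⟨k, by omega⟩]
          congr 1
          ext
          simp only [Equiv.Perm.mul_apply, val_finRotate]
          split_ifs <;> omega
    ext ⟨k, hk⟩
    exact key k hk
  simpa using LinearMap.finrank_le_finrank_of_injective hinj

/-- A function invariant under both `γσ` and `γ⁻¹σ` is `γ²`-invariant, so the two spaces meet in
dimension at most 2, while their sum lies in dimension `2q`. In case of equality the intersection
contains every `γ²`-invariant function, in particular the parity; its invariance under `γσ` says
that `σ` flips parity. -/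
theorem orbitCount_add_le_and_flipsParity {q : ℕ} (hq : 1 ≤ q) (σ : Equiv.Perm (Fin (2 * q))) :
    orbitCount (finRotate (2 * q) * σ) + orbitCount ((finRotate (2 * q))⁻¹ * σ) ≤ 2 * q + 2 ∧
    (orbitCount (finRotate (2 * q) * σ) + orbitCount ((finRotate (2 * q))⁻¹ * σ) = 2 * q + 2 →
      FlipsParity σ) := by
  set γ := finRotate (2 * q) with hγ
  rw [← finrank_invariantFunctions, ← finrank_invariantFunctions,
    ← Submodule.finrank_sup_add_finrank_inf_eq]
  have hle : invariantFunctions (γ * σ) ⊓ invariantFunctions (γ⁻¹ * σ) ≤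
      invariantFunctions (γ * γ) := by
    rintro f ⟨h1, h2⟩ j
    have h1' := h1 (σ.symm (γ j))
    have h2' := h2 (σ.symm (γ j))
    simp only [Equiv.Perm.mul_apply, Equiv.apply_symm_apply, Equiv.Perm.inv_def,
      Equiv.symm_apply_apply] at h1' h2' ⊢
    rw [h1', ← h2']
  have h2 : Module.finrank ℚ (invariantFunctions (γ * γ)) ≤ 2 :=
    finrank_invariantFunctions_finRotate_sq_le q hq
  have h3 := Submodule.finrank_mono hle
  have h4 := Submodule.finrank_le (invariantFunctions (γ * σ) ⊔ invariantFunctions (γ⁻¹ * σ))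
  rw [Module.finrank_fintype_fun_eq_card, Fintype.card_fin] at h4
  refine ⟨by omega, fun h => ?_⟩
  have heq := Submodule.eq_of_le_of_finrank_le hle (by omega)
  have hmem : (fun i : Fin (2 * q) => ((i.val % 2 : ℕ) : ℚ)) ∈ invariantFunctions (γ * γ) := by
    intro i
    simp only [Equiv.Perm.mul_apply, hγ]
    have := val_finRotate_mod_two i
    have := val_finRotate_mod_two (finRotate (2 * q) i)
    norm_cast
    omega
  rw [← heq] at hmem
  intro i
  have h5 := hmem.1 i
  simp only [Equiv.Perm.mul_apply, Nat.cast_inj, hγ] at h5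
  have := val_finRotate_mod_two (σ i)
  omega

/-! ### Noncrossing pairings characterized by orbit counts -/

/-- Fixed-point-free involutions without crossings. -/
structure IsNoncrossingPairing {N : ℕ} (σ : Equiv.Perm (Fin N)) : Prop where
  involutive : ∀ i, σ (σ i) = i
  apply_ne : ∀ i, σ i ≠ i
  not_crossing : ∀ a b, a < b → b < σ a → ¬ σ a < σ b

theorem card_lt_apply {q : ℕ} {σ : Equiv.Perm (Fin (2 * q))} (h1 : ∀ i, σ (σ i) = i)
    (h2 : ∀ i, σ i ≠ i) : (Finset.univ.filter fun i => i < σ i).card = q := by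
  have e : (Finset.univ.filter fun i => i < σ i).card =
      (Finset.univ.filter fun i => ¬ i < σ i).card := by
    refine Finset.card_bij (fun i _ => σ i) ?_ (fun _ _ _ _ h => σ.injective h) ?_
    · intro i hi
      simp only [Finset.mem_filter, Finset.mem_univ, true_and] at hi ⊢
      rw [h1]
      exact not_lt.2 hi.le
    · intro i hi
      simp only [Finset.mem_filter, Finset.mem_univ, true_and] at hi ⊢
      exact ⟨σ i, by rw [h1]; exact lt_of_le_of_ne (not_lt.1 hi) (h2 i), h1 i⟩
  have := Finset.card_filter_add_card_filter_not (s := (Finset.univ : Finset (Fin (2 * q))))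
    (fun i => i < σ i)
  rw [Finset.card_univ, Fintype.card_fin] at this
  omega

/-- The equations indexed by `S` cut the invariant functions down to constants, so the dimension is
at most their number plus 1. -/
theorem orbitCount_le_card_add_one {X : Type*} [Finite X] [Nonempty X] (π σ : Equiv.Perm X)
    (S : Finset X) (h : ∀ f : X → ℚ, (∀ x, f (π x) = f x) → (∀ i ∈ S, f i = f (σ i)) →
      ∀ x y, f x = f y) : orbitCount π ≤ S.card + 1 := by
  classical
  rw [← finrank_invariantFunctions]
  let x₀ : X := Classical.arbitrary X
  let pr : X → (X → ℚ) →ₗ[ℚ] ℚ := LinearMap.proj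
  let φ : (X → ℚ) →ₗ[ℚ] (S → ℚ) × ℚ :=
    (LinearMap.pi fun i : S => pr i - pr (σ i)).prod (pr x₀)
  have hinj : Function.Injective (φ.domRestrict (invariantFunctions π)) := by
    rw [← LinearMap.ker_eq_bot, LinearMap.ker_eq_bot']
    rintro ⟨f, hf⟩ h0
    have h1 : f x₀ = 0 := congrArg Prod.snd h0
    have h2 : ∀ i ∈ S, f i = f (σ i) := fun i hi =>
      sub_eq_zero.1 (congrFun (congrArg Prod.fst h0) ⟨i, hi⟩)
    ext x
    exact (h f hf h2 x x₀).trans h1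
  simpa using LinearMap.finrank_le_finrank_of_injective hinj

theorem eq_of_forall_succ_eq {R : Type*} (F : ℕ → R) (x y : ℕ)
    (h : ∀ k, x ≤ k → k < y → F (k + 1) = F k) (k : ℕ) (hk : x ≤ k) (hky : k ≤ y) :
    F k = F x := by
  induction k, hk using Nat.le_induction with
  | base => rfl
  | succ k hk ih => rw [h k hk (by omega), ih (by omega)]

/-- A function on the cycle `Fin n`, extended to `ℕ` by its value at `0`. -/
theorem exists_extension {n : ℕ} (hn : 0 < n) (f : Fin n → ℚ) :
    ∃ F : ℕ → ℚ, (∀ i : Fin n, F i = f i) ∧ (∀ i : Fin n, F (i + 1) = f (finRotate n i)) ∧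
      F n = F 0 := by
  refine ⟨fun k => if h : k < n then f ⟨k, h⟩ else f ⟨0, hn⟩, fun i => by simp, fun i => ?_,
    by simp [hn]⟩
  have hv := val_finRotate i
  dsimp only
  split_ifs with h <;> congr 1 <;> ext <;> simp only [hv] <;> split_ifs <;> omega

/-- Impose `f i = f (σ i)` at the `q` left ends of pairs: a function invariant under `γσ` and `σ` is
invariant under `γ`, hence constant. -/
theorem orbitCount_finRotate_mul_le {q : ℕ} (hq : 1 ≤ q) {σ : Equiv.Perm (Fin (2 * q))}
    (h1 : ∀ i, σ (σ i) = i) (h2 : ∀ i, σ i ≠ i) :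
    orbitCount (finRotate (2 * q) * σ) ≤ q + 1 := by
  have : Nonempty (Fin (2 * q)) := ⟨⟨0, by omega⟩⟩
  refine (orbitCount_le_card_add_one _ σ (Finset.univ.filter fun i => i < σ i)
    fun f hf hS => ?_).trans_eq (by rw [card_lt_apply h1 h2])
  obtain ⟨F, hF, hF1, hF2⟩ := exists_extension (by omega) f
  have hσ : ∀ i, f i = f (σ i) := by
    intro i
    rcases lt_or_gt_of_ne (h2 i) with h | h
    · have := hS (σ i) (by simpa [h1] using h)
      rw [h1] at this
      exact this.symm
    · exact hS i (by simpa using h)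
  have hγ : ∀ i, f (finRotate (2 * q) i) = f i := by
    intro i
    have := hf (σ i)
    rw [Equiv.Perm.mul_apply, h1] at this
    rw [this, ← hσ]
  have key : ∀ i, f i = F 0 := by
    intro i
    rw [← hF]
    refine eq_of_forall_succ_eq F 0 (2 * q) (fun k _ hk => ?_) i (Nat.zero_le _) i.2.le
    have e1 := hF1 ⟨k, hk⟩
    have e2 := hF ⟨k, hk⟩
    simp only at e1 e2
    rw [e1, e2, hγ]
  intro x y
  rw [key, key]

/-- If the pairs of `a` and `b` crossed, their two equations would be redundant, and the remaining
`q - 2` would bound the orbit count by `q - 1`. -/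
theorem not_crossing_of_orbitCount {q : ℕ} (hq : 1 ≤ q) {σ : Equiv.Perm (Fin (2 * q))}
    (h1 : ∀ i, σ (σ i) = i) (h2 : ∀ i, σ i ≠ i)
    (h : orbitCount (finRotate (2 * q) * σ) = q + 1) : IsNoncrossingPairing σ := by
  refine ⟨h1, h2, fun a b hab hbc hcd => ?_⟩
  have : Nonempty (Fin (2 * q)) := ⟨⟨0, by omega⟩⟩
  have hcard := card_lt_apply h1 h2
  set L := Finset.univ.filter fun i => i < σ i with hL
  have hle : orbitCount (finRotate (2 * q) * σ) ≤ ((L.erase a).erase b).card + 1 := by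
    refine orbitCount_le_card_add_one _ σ _ fun f hf hS => ?_
    obtain ⟨F, hF, hF1, hF2⟩ := exists_extension (by omega) f
    have hσ : ∀ i : Fin (2 * q), F (i + 1) = F (σ i) := by
      intro i
      have := hf (σ i)
      rw [Equiv.Perm.mul_apply, h1] at this
      rw [hF1, this, hF]
    have hS' : ∀ i, i ≠ a → i ≠ b → i < σ i → f i = f (σ i) := fun i hia hib hi =>
      hS i (by simp [hL, hia, hib, hi])
    have hstep : ∀ i : Fin (2 * q), i ≠ a → i ≠ b → i ≠ σ a → i ≠ σ b → F (i + 1) = F i := by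
      intro i ha hb hc hd
      rw [hσ, hF, hF]
      rcases lt_or_gt_of_ne (h2 i) with h | h
      · have := hS' (σ i) (fun e => hc (by rw [← e, h1])) (fun e => hd (by rw [← e, h1]))
          (by rwa [h1])
        rwa [h1] at this
      · exact (hS' i ha hb h).symm
    have hstep' : ∀ k, k < 2 * q → k ≠ a → k ≠ b → k ≠ σ a → k ≠ σ b → F (k + 1) = F k :=
      fun k hk ha hb hc hd => hstep ⟨k, hk⟩ (fun e => ha (by rw [← e])) (fun e => hb (by rw [← e]))
        (fun e => hc (by rw [← e])) (fun e => hd (by rw [← e]))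
    rw [Fin.lt_def] at hab hbc hcd
    have hd := (σ b).2
    have e0 := eq_of_forall_succ_eq F 0 a fun k _ _ => hstep' k (by omega) (by omega) (by omega)
      (by omega) (by omega)
    have e1 := eq_of_forall_succ_eq F (a + 1) b fun k _ _ => hstep' k (by omega) (by omega)
      (by omega) (by omega) (by omega)
    have e2 := eq_of_forall_succ_eq F (b + 1) (σ a) fun k _ _ => hstep' k (by omega) (by omega)
      (by omega) (by omega) (by omega)
    have e3 := eq_of_forall_succ_eq F (σ a + 1) (σ b) fun k _ _ => hstep' k (by omega) (by omega)
      (by omega) (by omega) (by omega)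
    have e4 := eq_of_forall_succ_eq F (σ b + 1) (2 * q) fun k _ _ => hstep' k (by omega) (by omega)
      (by omega) (by omega) (by omega)
    -- `F` is constant on each of the five intervals cut out by `a < b < σ a < σ b`; invariance
    -- under `γσ` at these four points glues the intervals together.
    have ja := hσ a
    have jb := hσ b
    have jc := hσ (σ a)
    have jd := hσ (σ b)
    rw [h1] at jc jd
    have k0 := e0 a (by omega) le_rfl
    have k2 := e2 (σ a) (by omega) le_rfl
    have k3 := e3 (σ b) (by omega) le_rfl
    have w3 : F (σ a + 1) = F 0 := jc.trans k0
    have w2 : F (b + 1) = F 0 := (jb.trans k3).trans w3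
    have w1 : F (a + 1) = F 0 := (ja.trans k2).trans w2
    have w4 : F (σ b + 1) = F 0 := by rw [← hF2, e4 _ (by omega) le_rfl]
    have key : ∀ i, f i = F 0 := by
      intro i
      rw [← hF]
      have := i.2
      by_cases c0 : i.val ≤ a
      · exact e0 i (by omega) c0
      by_cases c1 : i.val ≤ b
      · exact (e1 i (by omega) c1).trans w1
      by_cases c2 : i.val ≤ σ a
      · exact (e2 i (by omega) c2).trans w2
      by_cases c3 : i.val ≤ σ b
      · exact (e3 i (by omega) c3).trans w3
      · exact (e4 i (by omega) (by omega)).trans w4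
    intro x y
    rw [key, key]
  have ha : a ∈ L := by simp [hL, hab.trans hbc]
  have hb : b ∈ L.erase a := by simp [hL, hab.ne', hbc.trans hcd]
  rw [Finset.card_erase_of_mem hb, Finset.card_erase_of_mem ha] at hle
  omega

theorem IsNoncrossingPairing.apply_mem_Ioo {N : ℕ} {σ : Equiv.Perm (Fin N)}
    (h : IsNoncrossingPairing σ) {a i : Fin N} (hai : a < i) (hi : i < σ a) :
    a < σ i ∧ σ i < σ a := by
  have h1 := h.not_crossing a i hai hi
  have h2 : σ i ≠ σ a := fun e => hai.ne' (σ.injective e)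
  have h3 : σ i ≠ a := fun e => hi.ne (by rw [← e, h.involutive])
  have h4 : ¬ σ i < a := fun hlt =>
    h.not_crossing (σ i) a hlt (by rwa [h.involutive]) (by rwa [h.involutive])
  exact ⟨lt_of_le_of_ne (not_lt.1 h4) h3.symm, lt_of_le_of_ne (not_lt.1 h1) h2⟩

/-- The points strictly between the two ends of a pair are paired among themselves, so their number
is even. -/
theorem IsNoncrossingPairing.flipsParity {N : ℕ} {σ : Equiv.Perm (Fin N)}
    (h : IsNoncrossingPairing σ) : FlipsParity σ := by
  have key : ∀ a, a < σ a → (σ a).val % 2 = (a.val + 1) % 2 := by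
    intro a ha
    have hsum : ∑ i ∈ Finset.Ioo a (σ a), (1 : ZMod 2) = 0 := by
      refine Finset.sum_involution (fun i _ => σ i) (fun _ _ => by decide)
        (fun i _ _ => h.apply_ne i) (fun i hi => ?_) (fun i _ => h.involutive i)
      rw [Finset.mem_Ioo] at hi ⊢
      exact h.apply_mem_Ioo hi.1 hi.2
    rw [Finset.sum_const, nsmul_eq_mul, mul_one, Fin.card_Ioo, ZMod.natCast_eq_zero_iff] at hsum
    rw [Fin.lt_def] at ha
    omega
  intro i
  rcases lt_or_gt_of_ne (h.apply_ne i) with hi | hi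
  · have := key (σ i) (by rwa [h.involutive])
    rw [h.involutive] at this
    omega
  · exact key i hi

/-- The constant 1 and the indicators of the `q` intervals `(a, σ a]` are independent invariant
functions. Noncrossing gives invariance: `γ` shifts `[a, σ a)` onto `(a, σ a]`, and `σ` exchanges
these two intervals as well. -/
theorem IsNoncrossingPairing.le_orbitCount {q : ℕ} (hq : 1 ≤ q) {σ : Equiv.Perm (Fin (2 * q))}
    (h : IsNoncrossingPairing σ) : q + 1 ≤ orbitCount (finRotate (2 * q) * σ) := by
  let ind : {i // i < σ i} → Fin (2 * q) → ℚ := fun a x => if a.1 < x ∧ x ≤ σ a.1 then 1 else 0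
  have hind : ∀ a, ind a ∈ invariantFunctions (finRotate (2 * q) * σ) := by
    rintro ⟨a, ha⟩ i
    obtain ⟨j, rfl⟩ : ∃ j, i = σ j := ⟨σ i, (h.involutive i).symm⟩
    have hv := val_finRotate j
    have hiff : (a < finRotate (2 * q) j ∧ finRotate (2 * q) j ≤ σ a) ↔
        (a < σ j ∧ σ j ≤ σ a) := by
      have e1 : (a < finRotate (2 * q) j ∧ finRotate (2 * q) j ≤ σ a) ↔ a ≤ j ∧ j < σ a := by
        have := (σ a).2
        simp only [Fin.lt_def, Fin.le_def, hv]
        split_ifs <;> omega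
      rw [e1]
      constructor
      · rintro ⟨h1, h2⟩
        rcases h1.eq_or_lt with rfl | h1
        · exact ⟨ha, le_rfl⟩
        · exact ⟨(h.apply_mem_Ioo h1 h2).1, (h.apply_mem_Ioo h1 h2).2.le⟩
      · rintro ⟨h1, h2⟩
        rcases h2.eq_or_lt with h2 | h2
        · rw [σ.injective h2]
          exact ⟨le_rfl, ha⟩
        · have := h.apply_mem_Ioo h1 h2
          rw [h.involutive] at this
          exact ⟨this.1.le, this.2⟩
    simp only [ind, Equiv.Perm.mul_apply, h.involutive, hiff]
  let v : Option {i // i < σ i} → invariantFunctions (finRotate (2 * q) * σ) := fun o =>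
    o.elim ⟨fun _ => 1, fun _ => rfl⟩ fun a => ⟨ind a, hind a⟩
  have hli : LinearIndependent ℚ v := by
    rw [Fintype.linearIndependent_iff]
    intro g hg
    have hx : ∀ x, g none + ∑ a, g (some a) * ind a x = 0 := by
      intro x
      have := congrFun (congrArg Subtype.val hg) x
      simpa [Fintype.sum_option, v] using this
    have hnone : g none = 0 := by
      have := hx ⟨0, by omega⟩
      rwa [Finset.sum_eq_zero, add_zero] at this
      intro a _
      simp only [ind]
      rw [if_neg fun h => Nat.not_lt_zero _ h.1, mul_zero]
    -- The system is triangular: at the point `a + 1` only intervals with left end at most `a`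
    -- contribute.
    have hsome : ∀ k, ∀ a : {i // i < σ i}, a.1.val = k → g (some a) = 0 := by
      intro k
      induction k using Nat.strong_induction_on with
      | _ k ih =>
        intro a hak
        have ha := a.2
        rw [Fin.lt_def] at ha
        have := (σ a.1).2
        have h0 := hx ⟨a.1 + 1, by omega⟩
        rw [hnone, zero_add, Finset.sum_eq_single a] at h0
        · have h1 : ind a ⟨a.1 + 1, by omega⟩ = 1 := if_pos ⟨Nat.lt_succ_self _, ha⟩
          rwa [h1, mul_one] at h0
        · intro b _ hb
          rcases lt_trichotomy b.1.val k with hlt | heq | hgt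
          · rw [ih b.1 hlt b rfl, zero_mul]
          · exact absurd (Subtype.ext (Fin.ext (heq.trans hak.symm))) hb
          · have : ¬ b.1.val < a.1.val + 1 := by omega
            simp only [ind]
            rw [if_neg fun h => this h.1, mul_zero]
        · simp
    intro o
    cases o with
    | none => exact hnone
    | some a => exact hsome _ a rfl
  have := hli.fintype_card_le_finrank
  rwa [finrank_invariantFunctions, Fintype.card_option, Fintype.card_subtype,
    card_lt_apply h.involutive h.apply_ne] at this

/-! ### Splitting a parity-flipping permutation into two involutions -/

/-- Swapping the even coordinates identifies pairs of functions invariant under `γσ` and `γ⁻¹σ`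
with pairs of functions invariant under `γσ₁` and `γσ₂`. -/
theorem orbitCount_add_eq {q : ℕ} {σ σ₁ σ₂ : Equiv.Perm (Fin (2 * q))}
    (h1 : ∀ i, σ₁ (σ₁ i) = i) (h2 : ∀ i, σ₂ (σ₂ i) = i) (p1 : FlipsParity σ₁)
    (p2 : FlipsParity σ₂) (e1 : ∀ i, i.val % 2 = 0 → σ i = σ₁ i)
    (e2 : ∀ i, i.val % 2 ≠ 0 → σ i = σ₂ i) :
    orbitCount (finRotate (2 * q) * σ) + orbitCount ((finRotate (2 * q))⁻¹ * σ) =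
      orbitCount (finRotate (2 * q) * σ₁) + orbitCount (finRotate (2 * q) * σ₂) := by
  have hγ := fun i => val_finRotate_mod_two (q := q) i
  have hγ' := fun i => val_finRotate_inv_mod_two (q := q) i
  set γ := finRotate (2 * q)
  have hc : ∀ i, γ (γ⁻¹ i) = i := fun i => γ.apply_symm_apply i
  have hc' : ∀ i, γ⁻¹ (γ i) = i := fun i => γ.symm_apply_apply i
  -- Comparing powers of 2 turns a sum of orbit counts into a count of pairs of two-valued invariant
  -- functions.
  refine Nat.pow_right_injective (le_refl 2) ?_
  have hcard := fun π : Equiv.Perm (Fin (2 * q)) => card_invariant (Fin 2) π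
  simp only [Nat.card_eq_fintype_card (α := Fin 2), Fintype.card_fin] at hcard
  simp only [pow_add]
  simp only [← hcard, ← Nat.card_prod, Equiv.Perm.mul_apply]
  -- For a pair `(f, g)` put `h = g ∘ γ⁻¹`. All relations link points of equal parity: `f` on evens
  -- and `h` on odds obey those of `γσ₁`, while `h` on evens and `f` on odds obey those of `γσ₂`.
  refine Nat.card_congr
    { toFun := fun u =>
        (⟨fun i => if i.val % 2 = 0 then u.1.1 i else u.2.1 (γ⁻¹ i), fun i => ?_⟩,
         ⟨fun i => if i.val % 2 = 0 then u.2.1 (γ⁻¹ i) else u.1.1 i, fun i => ?_⟩)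
      invFun := fun u =>
        (⟨fun i => if i.val % 2 = 0 then u.1.1 i else u.2.1 i, fun i => ?_⟩,
         ⟨fun i => if i.val % 2 = 0 then u.1.1 (γ i) else u.2.1 (γ i), fun i => ?_⟩)
      left_inv := fun u => ?_
      right_inv := fun u => ?_ }
  · beta_reduce
    have a1 := hγ (σ₁ i)
    have a2 := p1 i
    by_cases hi : i.val % 2 = 0
    · rw [if_pos hi, if_pos (by omega), ← e1 i hi]
      exact u.1.2 i
    · rw [if_neg hi, if_neg (by omega), hc']
      have := u.2.2 (σ₁ i)
      rw [e1 _ (by omega), h1] at this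
      exact this.symm
  · beta_reduce
    have a1 := hγ (σ₂ i)
    have a2 := p2 i
    by_cases hi : i.val % 2 = 0
    · rw [if_pos hi, if_pos (by omega), hc']
      have := u.2.2 (σ₂ i)
      rw [e2 _ (by omega), h2] at this
      exact this.symm
    · rw [if_neg hi, if_neg (by omega), ← e2 i hi]
      exact u.1.2 i
  · beta_reduce
    have a1 := hγ (σ i)
    by_cases hi : i.val % 2 = 0
    · have a2 := p1 i
      rw [e1 i hi] at a1 ⊢
      rw [if_pos hi, if_pos (by omega)]
      exact u.1.2 i
    · have a2 := p2 i
      rw [e2 i hi] at a1 ⊢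
      rw [if_neg hi, if_neg (by omega)]
      exact u.2.2 i
  · beta_reduce
    have a1 := hγ' (σ i)
    by_cases hi : i.val % 2 = 0
    · have a2 := p1 i
      rw [e1 i hi] at a1 ⊢
      rw [if_pos hi, if_pos (by omega), hc, ← u.1.2 (σ₁ i), h1]
    · have a2 := p2 i
      rw [e2 i hi] at a1 ⊢
      rw [if_neg hi, if_neg (by omega), hc, ← u.2.2 (σ₂ i), h2]
  · refine Prod.ext (Subtype.ext (funext fun i => ?_)) (Subtype.ext (funext fun i => ?_))
    · by_cases hi : i.val % 2 = 0 <;> simp [hi]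
    · have := hγ i
      by_cases hi : i.val % 2 = 0
      · have : (γ i).val % 2 ≠ 0 := by omega
        simp only [hi, this, if_true, if_false, hc']
      · have : (γ i).val % 2 = 0 := by omega
        simp only [hi, this, if_true, if_false, hc']
  · refine Prod.ext (Subtype.ext (funext fun i => ?_)) (Subtype.ext (funext fun i => ?_))
    · have := hγ' i
      by_cases hi : i.val % 2 = 0
      · simp only [hi, if_true]
      · have : (γ⁻¹ i).val % 2 = 0 := by omega
        simp only [hi, this, if_true, if_false, hc]
    · have := hγ' i
      by_cases hi : i.val % 2 = 0
      · have : (γ⁻¹ i).val % 2 ≠ 0 := by omega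
        simp only [hi, this, if_true, if_false, hc]
      · simp only [hi, if_false]

/-! ### Meanders and the permutations traversing them -/

theorem Finpartition.eq_of_part_eq {α : Type*} [DecidableEq α] {s : Finset α}
    {τ τ' : Finpartition s} (h : ∀ i, τ.part i = τ'.part i) : τ = τ' := by
  have key : ∀ (τ τ' : Finpartition s), (∀ i, τ.part i = τ'.part i) → τ.parts ⊆ τ'.parts := by
    intro τ τ' h B hB
    obtain ⟨i, hi, rfl⟩ := τ.part_surjOn hB
    rw [h i]
    exact τ'.part_mem.2 hi
  exact Finpartition.ext ((key τ τ' h).antisymm (key τ' τ fun i => (h i).symm))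

/-- The blocks of `τ` are the orbits of the involution `σ`. -/
def IsPairingOf {N : ℕ} (τ : Finpartition (Finset.univ : Finset (Fin N)))
    (σ : Equiv.Perm (Fin N)) : Prop := ∀ i, τ.part i = {i, σ i}

theorem IsPairingOf.exists_mem_parts_iff {N : ℕ} {τ : Finpartition (Finset.univ : Finset (Fin N))}
    {σ : Equiv.Perm (Fin N)} (h : IsPairingOf τ σ) (i j : Fin N) :
    (∃ B ∈ τ.parts, i ∈ B ∧ j ∈ B) ↔ i = j ∨ i = σ j := by
  rw [← τ.mem_part_iff_exists, h j]
  simp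

theorem exists_isPairingOf_perm {N : ℕ} {τ : Finpartition (Finset.univ : Finset (Fin N))}
    (hτ : τ ∈ NC₂ N) : ∃ σ, IsNoncrossingPairing σ ∧ IsPairingOf τ σ := by
  have hex : ∀ i, ∃ j, j ≠ i ∧ τ.part i = {i, j} := by
    intro i
    obtain ⟨x, y, hxy, he⟩ := Finset.card_eq_two.1 (hτ.2 _ (τ.part_mem.2 (Finset.mem_univ i)))
    have hi : i ∈ ({x, y} : Finset (Fin N)) := he ▸ τ.mem_part (Finset.mem_univ i)
    rcases Finset.mem_insert.1 hi with rfl | hi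
    · exact ⟨y, hxy.symm, he⟩
    · rw [Finset.mem_singleton] at hi
      subst hi
      exact ⟨x, hxy, by rw [he, Finset.pair_comm]⟩
  choose s hs hpart using hex
  have hmem : ∀ i j, j ∈ τ.part i → τ.part j = τ.part i := fun i j hj =>
    τ.part_eq_of_mem (τ.part_mem.2 (Finset.mem_univ i)) hj
  have hinv : Function.Involutive s := by
    intro i
    have h1 : τ.part (s i) = τ.part i := hmem i (s i) (by rw [hpart i]; simp)
    have h2 : i ∈ τ.part (s i) := h1 ▸ τ.mem_part (Finset.mem_univ i)
    rw [hpart (s i)] at h2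
    rcases Finset.mem_insert.1 h2 with h2 | h2
    · exact absurd h2.symm (hs i)
    · exact (Finset.mem_singleton.1 h2).symm
  refine ⟨hinv.toPerm, ⟨hinv, hs, fun a b hab hbc hcd => ?_⟩, hpart⟩
  have hB := hτ.1 _ (τ.part_mem.2 (Finset.mem_univ a)) _ (τ.part_mem.2 (Finset.mem_univ b))
    a b (s a) (s b) hab hbc hcd (by rw [hpart a]; simp) (by rw [hpart a]; simp)
    (by rw [hpart b]; simp) (by rw [hpart b]; simp)
  have hb : b ∈ τ.part a := hB ▸ τ.mem_part (Finset.mem_univ b)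
  rw [hpart a] at hb
  rcases Finset.mem_insert.1 hb with hb | hb
  · exact hab.ne' hb
  · exact hbc.ne (Finset.mem_singleton.1 hb)

theorem exists_finpartition_isPairingOf {N : ℕ} {σ : Equiv.Perm (Fin N)}
    (hσ : IsNoncrossingPairing σ) : ∃ τ ∈ NC₂ N, IsPairingOf τ σ := by
  classical
  let S : Setoid (Fin N) :=
    { r := fun i j => j = i ∨ j = σ i
      iseqv :=
        { refl := fun _ => Or.inl rfl
          symm := by
            rintro i j (rfl | rfl)
            · exact Or.inl rfl
            · exact Or.inr (hσ.involutive i).symm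
          trans := by
            rintro i j k (rfl | rfl) (rfl | rfl)
            · exact Or.inl rfl
            · exact Or.inr rfl
            · exact Or.inr rfl
            · exact Or.inl (hσ.involutive i) } }
  have hpart : IsPairingOf (Finpartition.ofSetoid S) σ := by
    intro i
    ext j
    rw [Finpartition.mem_part_ofSetoid_iff_rel]
    simp only [Finset.mem_insert, Finset.mem_singleton]
    exact Iff.rfl
  have hB : ∀ B ∈ (Finpartition.ofSetoid S).parts, ∀ i ∈ B, B = {i, σ i} := fun B hB i hi => by
    rw [← hpart i, (Finpartition.ofSetoid S).part_eq_of_mem hB hi]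
  refine ⟨Finpartition.ofSetoid S, ⟨fun B h B' h' a b c d hab hbc hcd ha hc hb hd => ?_,
    fun B h => ?_⟩, hpart⟩
  · rw [hB B h a ha, Finset.mem_insert, Finset.mem_singleton] at hc
    rw [hB B' h' b hb, Finset.mem_insert, Finset.mem_singleton] at hd
    obtain rfl := hc.resolve_left (hab.trans hbc).ne'
    obtain rfl := hd.resolve_left (hbc.trans hcd).ne'
    exact absurd hcd (hσ.not_crossing a b hab hbc)
  · obtain ⟨i, hi⟩ := (Finpartition.ofSetoid S).nonempty_of_mem_parts h
    rw [hB B h i hi, Finset.card_pair (hσ.apply_ne i).symm]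

/-- `σ` runs along the meander with upper roads `τ.1` and lower roads `τ.2`, taking a road of
`τ.1` at the even bridges and one of `τ.2` at the odd bridges. -/
def TraversesMeander {N : ℕ} (τ : Finpartition (Finset.univ : Finset (Fin N)) ×
    Finpartition (Finset.univ : Finset (Fin N))) (σ : Equiv.Perm (Fin N)) : Prop :=
  ∃ σ₁ σ₂ : Equiv.Perm (Fin N), IsNoncrossingPairing σ₁ ∧ IsNoncrossingPairing σ₂ ∧
    IsPairingOf τ.1 σ₁ ∧ IsPairingOf τ.2 σ₂ ∧
    (∀ i, i.val % 2 = 0 → σ i = σ₁ i) ∧ (∀ i, i.val % 2 ≠ 0 → σ i = σ₂ i)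

/-- Both pairings flip parity, so gluing them along parity gives a bijection; the inverse has their
roles exchanged. -/
theorem exists_traversesMeander {N : ℕ} {τ : Finpartition (Finset.univ : Finset (Fin N)) ×
    Finpartition (Finset.univ : Finset (Fin N))} (h1 : τ.1 ∈ NC₂ N) (h2 : τ.2 ∈ NC₂ N) :
    ∃ σ, TraversesMeander τ σ := by
  obtain ⟨σ₁, n1, q1⟩ := exists_isPairingOf_perm h1
  obtain ⟨σ₂, n2, q2⟩ := exists_isPairingOf_perm h2
  refine ⟨⟨fun i => if i.val % 2 = 0 then σ₁ i else σ₂ i,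
    fun i => if i.val % 2 = 0 then σ₂ i else σ₁ i, fun i => ?_, fun i => ?_⟩,
    σ₁, σ₂, n1, n2, q1, q2, fun i hi => if_pos hi, fun i hi => if_neg hi⟩
  all_goals
    have p1 := n1.flipsParity i
    have p2 := n2.flipsParity i
    by_cases hi : i.val % 2 = 0
    · have h1 : (σ₁ i).val % 2 ≠ 0 := by omega
      have h2 : (σ₂ i).val % 2 ≠ 0 := by omega
      simp only [hi, h1, h2, if_true, if_false, n1.involutive, n2.involutive]
    · have h1 : (σ₁ i).val % 2 = 0 := by omega
      have h2 : (σ₂ i).val % 2 = 0 := by omega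
      simp only [hi, h1, h2, if_true, if_false, n1.involutive, n2.involutive]

/-- The values of `σ` on evens are completed to an involution by `σ⁻¹` on odds. -/
theorem FlipsParity.exists_involutions {N : ℕ} {σ : Equiv.Perm (Fin N)} (h : FlipsParity σ) :
    ∃ σ₁ : Equiv.Perm (Fin N), (∀ i, σ₁ (σ₁ i) = i) ∧ FlipsParity σ₁ ∧
      (∀ i, i.val % 2 = 0 → σ₁ i = σ i) ∧ (∀ i, i.val % 2 ≠ 0 → σ₁ i = σ.symm i) := by
  have h' : ∀ i, (σ.symm i).val % 2 = (i.val + 1) % 2 := by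
    intro i
    have := h (σ.symm i)
    rw [σ.apply_symm_apply] at this
    omega
  have hinv : Function.Involutive fun i : Fin N => if i.val % 2 = 0 then σ i else σ.symm i := by
    intro i
    have p1 := h i
    have p2 := h' i
    by_cases hi : i.val % 2 = 0
    · have : (σ i).val % 2 ≠ 0 := by omega
      simp only [hi, this, if_true, if_false, σ.symm_apply_apply]
    · have : (σ.symm i).val % 2 = 0 := by omega
      simp only [hi, this, if_true, if_false, σ.apply_symm_apply]
  refine ⟨hinv.toPerm, hinv, fun i => ?_, fun i hi => if_pos hi, fun i hi => if_neg hi⟩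
  change (if i.val % 2 = 0 then σ i else σ.symm i).val % 2 = _
  split_ifs
  · exact h i
  · exact h' i

theorem FlipsParity.exists_involutions_odd {N : ℕ} {σ : Equiv.Perm (Fin N)}
    (h : FlipsParity σ) :
    ∃ σ₂ : Equiv.Perm (Fin N), (∀ i, σ₂ (σ₂ i) = i) ∧ FlipsParity σ₂ ∧
      (∀ i, i.val % 2 ≠ 0 → σ₂ i = σ i) := by
  have h' : FlipsParity σ.symm := by
    intro i
    have := h (σ.symm i)
    rw [σ.apply_symm_apply] at this
    omega
  obtain ⟨σ₂, h1, h2, _, h4⟩ := h'.exists_involutions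
  exact ⟨σ₂, h1, h2, fun i hi => by rw [h4 i hi, Equiv.symm_symm]⟩

theorem FlipsParity.apply_ne {N : ℕ} {σ : Equiv.Perm (Fin N)} (h : FlipsParity σ) (i : Fin N) :
    σ i ≠ i := by
  intro e
  have := h i
  rw [e] at this
  omega

/-- Two orbit counts, each at most `q + 1`, add up to `2q + 2`; both bounds are attained, so both
involutions are noncrossing. -/
theorem exists_meander_of_orbitCount_add_eq {q : ℕ} (hq : 1 ≤ q) {σ : Equiv.Perm (Fin (2 * q))}
    (h : orbitCount (finRotate (2 * q) * σ) + orbitCount ((finRotate (2 * q))⁻¹ * σ) =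
      2 * q + 2) :
    ∃ τ, (τ.1 ∈ NC₂ (2 * q) ∧ τ.2 ∈ NC₂ (2 * q)) ∧ TraversesMeander τ σ := by
  have hp := (orbitCount_add_le_and_flipsParity hq σ).2 h
  obtain ⟨σ₁, i1, p1, e1, _⟩ := hp.exists_involutions
  obtain ⟨σ₂, i2, p2, e2⟩ := hp.exists_involutions_odd
  have heq := orbitCount_add_eq (σ := σ) i1 i2 p1 p2 (fun i hi => (e1 i hi).symm)
    (fun i hi => (e2 i hi).symm)
  have b1 := orbitCount_finRotate_mul_le hq i1 p1.apply_ne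
  have b2 := orbitCount_finRotate_mul_le hq i2 p2.apply_ne
  have n1 := not_crossing_of_orbitCount hq i1 p1.apply_ne (by omega)
  have n2 := not_crossing_of_orbitCount hq i2 p2.apply_ne (by omega)
  obtain ⟨τ₁, m1, q1⟩ := exists_finpartition_isPairingOf n1
  obtain ⟨τ₂, m2, q2⟩ := exists_finpartition_isPairingOf n2
  exact ⟨(τ₁, τ₂), ⟨m1, m2⟩, σ₁, σ₂, n1, n2, q1, q2, fun i hi => (e1 i hi).symm,
    fun i hi => (e2 i hi).symm⟩

theorem TraversesMeander.orbitCount_add_eq {q : ℕ} (hq : 1 ≤ q)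
    {τ : Finpartition (Finset.univ : Finset (Fin (2 * q))) ×
      Finpartition (Finset.univ : Finset (Fin (2 * q)))} {σ : Equiv.Perm (Fin (2 * q))}
    (h : TraversesMeander τ σ) :
    orbitCount (finRotate (2 * q) * σ) + orbitCount ((finRotate (2 * q))⁻¹ * σ) =
      2 * q + 2 := by
  obtain ⟨σ₁, σ₂, n1, n2, _, _, e1, e2⟩ := h
  rw [_root_.orbitCount_add_eq n1.involutive n2.involutive n1.flipsParity n2.flipsParity e1 e2]
  have := orbitCount_finRotate_mul_le hq n1.involutive n1.apply_ne
  have := orbitCount_finRotate_mul_le hq n2.involutive n2.apply_ne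
  have := n1.le_orbitCount hq
  have := n2.le_orbitCount hq
  omega

theorem TraversesMeander.flipsParity {N : ℕ} {τ : Finpartition (Finset.univ : Finset (Fin N)) ×
    Finpartition (Finset.univ : Finset (Fin N))} {σ : Equiv.Perm (Fin N)}
    (h : TraversesMeander τ σ) : FlipsParity σ := by
  obtain ⟨σ₁, σ₂, n1, n2, _, _, e1, e2⟩ := h
  intro i
  by_cases hi : i.val % 2 = 0
  · rw [e1 i hi]; exact n1.flipsParity i
  · rw [e2 i hi]; exact n2.flipsParity i

/-- Each pair has one point of either parity, so one parity class determines the pairing. -/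
theorem perm_eq_of_eq_on {N : ℕ} {σ σ' : Equiv.Perm (Fin N)} (r : ℕ)
    (h : IsNoncrossingPairing σ) (h' : IsNoncrossingPairing σ')
    (he : ∀ i, i.val % 2 = r % 2 → σ i = σ' i) : σ = σ' := by
  ext1 i
  by_cases hi : i.val % 2 = r % 2
  · exact he i hi
  · have := h.flipsParity i
    have hk := he (σ i) (by omega)
    rw [h.involutive] at hk
    conv_rhs => rw [hk]
    rw [h'.involutive]

theorem TraversesMeander.unique {N : ℕ} {τ τ' : Finpartition (Finset.univ : Finset (Fin N)) ×
    Finpartition (Finset.univ : Finset (Fin N))} {σ : Equiv.Perm (Fin N)}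
    (h : TraversesMeander τ σ) (h' : TraversesMeander τ' σ) : τ = τ' := by
  obtain ⟨σ₁, σ₂, n1, n2, q1, q2, e1, e2⟩ := h
  obtain ⟨σ₁', σ₂', n1', n2', q1', q2', e1', e2'⟩ := h'
  obtain rfl : σ₁ = σ₁' := perm_eq_of_eq_on 0 n1 n1' fun i hi => by rw [← e1 i hi, e1' i hi]
  obtain rfl : σ₂ = σ₂' := perm_eq_of_eq_on 1 n2 n2' fun i hi => by
    rw [← e2 i (by omega), e2' i (by omega)]
  exact Prod.ext (Finpartition.eq_of_part_eq fun i => by rw [q1, q1'])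
    (Finpartition.eq_of_part_eq fun i => by rw [q2, q2'])

/-- The closed curves of a meander are the orbits of the permutation traversing it. -/
theorem TraversesMeander.card_connectedComponent {N : ℕ}
    {τ : Finpartition (Finset.univ : Finset (Fin N)) ×
      Finpartition (Finset.univ : Finset (Fin N))} {σ : Equiv.Perm (Fin N)}
    (h : TraversesMeander τ σ) :
    Nat.card (meanderGraph τ.1 τ.2).ConnectedComponent = orbitCount σ := by
  have hp := h.flipsParity
  obtain ⟨σ₁, σ₂, n1, n2, q1, q2, e1, e2⟩ := h
  have hadj : ∀ i, (meanderGraph τ.1 τ.2).Adj (σ i) i := by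
    intro i
    rw [meanderGraph, SimpleGraph.fromRel_adj]
    refine ⟨hp.apply_ne i, Or.inl ?_⟩
    rw [q1.exists_mem_parts_iff, q2.exists_mem_parts_iff]
    by_cases hi : i.val % 2 = 0
    · exact Or.inl (Or.inr (e1 i hi))
    · exact Or.inr (Or.inr (e2 i hi))
  -- At odd points a road of `σ₁` is a step of `σ` run backwards; likewise for `σ₂` at even points.
  have hstep1 : ∀ i, σ.SameCycle (σ₁ i) i := by
    intro i
    by_cases hi : i.val % 2 = 0
    · rw [← e1 i hi]
      exact Equiv.Perm.sameCycle_apply_left.2 (Equiv.Perm.SameCycle.refl σ i)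
    · have := n1.flipsParity i
      have := e1 (σ₁ i) (by omega)
      rw [n1.involutive] at this
      exact Equiv.Perm.sameCycle_apply_left.1 ⟨0, by simp [this]⟩
  have hstep2 : ∀ i, σ.SameCycle (σ₂ i) i := by
    intro i
    by_cases hi : i.val % 2 = 0
    · have := n2.flipsParity i
      have := e2 (σ₂ i) (by omega)
      rw [n2.involutive] at this
      exact Equiv.Perm.sameCycle_apply_left.1 ⟨0, by simp [this]⟩
    · rw [← e2 i hi]
      exact Equiv.Perm.sameCycle_apply_left.2 (Equiv.Perm.SameCycle.refl σ i)
  have hrel : ∀ i j, ((∃ B ∈ τ.1.parts, i ∈ B ∧ j ∈ B) ∨ (∃ B ∈ τ.2.parts, i ∈ B ∧ j ∈ B)) →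
      σ.SameCycle i j := by
    intro i j
    rw [q1.exists_mem_parts_iff, q2.exists_mem_parts_iff]
    rintro ((rfl | rfl) | (rfl | rfl))
    · exact Equiv.Perm.SameCycle.refl _ _
    · exact hstep1 j
    · exact Equiv.Perm.SameCycle.refl _ _
    · exact hstep2 j
  refine Nat.card_congr (Quot.congr (Equiv.refl _) fun i j => ?_ :
    Quot (meanderGraph τ.1 τ.2).Reachable ≃ Quot σ.SameCycle)
  change (meanderGraph τ.1 τ.2).Reachable i j ↔ σ.SameCycle i j
  constructor
  · rintro ⟨w⟩
    induction w with
    | nil => exact Equiv.Perm.SameCycle.refl _ _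
    | cons hadj _ ih =>
      rw [meanderGraph, SimpleGraph.fromRel_adj] at hadj
      exact (hadj.2.elim (hrel _ _) fun h => (hrel _ _ h).symm).trans ih
  · intro hc
    have := apply_eq_of_sameCycle (f := (meanderGraph τ.1 τ.2).connectedComponentMk)
      (fun x => SimpleGraph.ConnectedComponent.sound (hadj x).reachable) hc
    exact SimpleGraph.ConnectedComponent.exact this

/-- Every orbit contains one of the `q` even points. -/
theorem FlipsParity.orbitCount_mem_Icc {q : ℕ} (hq : 1 ≤ q) {σ : Equiv.Perm (Fin (2 * q))}
    (h : FlipsParity σ) : orbitCount σ ∈ Finset.Icc 1 q := by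
  have : Nonempty (Quotient (Equiv.Perm.SameCycle.setoid σ)) := ⟨⟦⟨0, by omega⟩⟧⟩
  rw [Finset.mem_Icc]
  refine ⟨Nat.card_pos, ?_⟩
  let g : Fin q → Quotient (Equiv.Perm.SameCycle.setoid σ) := fun k => ⟦⟨2 * k.val, by omega⟩⟧
  have hg : Function.Surjective g := by
    have heven : ∀ i : Fin (2 * q), i.val % 2 = 0 → ∃ k, g k = ⟦i⟧ := by
      intro i hi
      refine ⟨⟨i.val / 2, by omega⟩, ?_⟩
      simp only [g]
      congr 1
      ext
      simp only
      omega
    intro a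
    induction a using Quotient.inductionOn with
    | _ i =>
      by_cases hi : i.val % 2 = 0
      · exact heven i hi
      · have := h i
        obtain ⟨k, hk⟩ := heven (σ i) (by omega)
        refine ⟨k, hk.trans (Quotient.sound ?_)⟩
        exact Equiv.Perm.sameCycle_apply_left.2 (Equiv.Perm.SameCycle.refl σ i)
  have := Nat.card_le_card_of_surjective g hg
  rwa [Nat.card_eq_fintype_card (α := Fin q), Fintype.card_fin] at this

theorem sum_eq_eval_meanderPolynomial {q : ℕ} (hq : 1 ≤ q) (x : ℝ) :
    ∑ σ : Equiv.Perm (Fin (2 * q)), (if orbitCount (finRotate (2 * q) * σ) +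
        orbitCount ((finRotate (2 * q))⁻¹ * σ) = 2 * q + 2 then x ^ orbitCount σ else 0) =
      (meanderPolynomial q).eval x := by
  classical
  let P : Finset (Finpartition (Finset.univ : Finset (Fin (2 * q))) ×
      Finpartition (Finset.univ : Finset (Fin (2 * q)))) :=
    (Set.toFinite {τ | τ.1 ∈ NC₂ (2 * q) ∧ τ.2 ∈ NC₂ (2 * q)}).toFinset
  have hP : ∀ τ, τ ∈ P ↔ τ.1 ∈ NC₂ (2 * q) ∧ τ.2 ∈ NC₂ (2 * q) := fun τ => by simp [P]
  have hex : ∀ τ ∈ P, ∃ σ, TraversesMeander τ σ := fun τ hτ =>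
    exists_traversesMeander ((hP τ).1 hτ).1 ((hP τ).1 hτ).2
  choose f hf using hex
  have hcard : ∀ k, meanderNumber q k =
      (P.filter fun τ => Nat.card (meanderGraph τ.1 τ.2).ConnectedComponent = k).card := by
    intro k
    rw [meanderNumber, ← Set.ncard_coe_finset]
    congr 1
    ext τ
    simp [hP, and_assoc]
  rw [← Finset.sum_filter, meanderPolynomial, Polynomial.eval_finsetSum]
  simp only [Polynomial.eval_mul, Polynomial.eval_C, Polynomial.eval_pow, Polynomial.eval_X]
  have hfib := Finset.sum_fiberwise_of_maps_to (s := P) (t := Finset.Icc 1 q)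
    (g := fun τ => Nat.card (meanderGraph τ.1 τ.2).ConnectedComponent)
    (fun τ hτ => by
      rw [(hf τ hτ).card_connectedComponent]
      exact (hf τ hτ).flipsParity.orbitCount_mem_Icc hq)
    (fun τ => x ^ Nat.card (meanderGraph τ.1 τ.2).ConnectedComponent)
  have hfib' : ∑ k ∈ Finset.Icc 1 q, (meanderNumber q k : ℝ) * x ^ k =
      ∑ τ ∈ P, x ^ Nat.card (meanderGraph τ.1 τ.2).ConnectedComponent := by
    rw [← hfib]
    refine Finset.sum_congr rfl fun k _ => ?_
    rw [Finset.sum_congr rfl fun τ hτ => by rw [(Finset.mem_filter.1 hτ).2], Finset.sum_const,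
      nsmul_eq_mul, hcard]
  rw [hfib']
  symm
  refine Finset.sum_bij f ?_ ?_ ?_ ?_
  · intro τ hτ
    simpa using (hf τ hτ).orbitCount_add_eq hq
  · intro τ hτ τ' hτ' he
    exact (hf τ hτ).unique (he ▸ hf τ' hτ')
  · intro σ hσ
    obtain ⟨τ, hτ, ht⟩ := exists_meander_of_orbitCount_add_eq hq (Finset.mem_filter.1 hσ).2
    refine ⟨τ, (hP τ).2 hτ, ?_⟩
    obtain ⟨σ₁, σ₂, n1, n2, q1, q2, e1, e2⟩ := ht
    obtain ⟨σ₁', σ₂', n1', n2', q1', q2', e1', e2'⟩ := hf τ ((hP τ).2 hτ)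
    -- A pairing is determined by its blocks, so the chosen `f τ` coincides with the given `σ`.
    have aux : ∀ {τ : Finpartition (Finset.univ : Finset (Fin (2 * q)))}
        {π π' : Equiv.Perm (Fin (2 * q))}, IsNoncrossingPairing π → IsPairingOf τ π →
        IsPairingOf τ π' → ∀ i, π' i = π i := by
      intro τ π π' hn h h' i
      have hm : π i ∈ ({i, π' i} : Finset (Fin (2 * q))) := by rw [← h' i, h i]; simp
      rcases Finset.mem_insert.1 hm with hm | hm
      · exact absurd hm (hn.apply_ne i)
      · exact (Finset.mem_singleton.1 hm).symm
    ext1 i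
    by_cases hi : i.val % 2 = 0
    · rw [e1' i hi, e1 i hi, aux n1 q1 q1']
    · rw [e2' i hi, e2 i hi, aux n2 q2 q2']
  · intro τ hτ
    rw [(hf τ hτ).card_connectedComponent]

/-! ### Asymptotics -/

theorem orbitCount_pos {X : Type*} [Finite X] [Nonempty X] (σ : Equiv.Perm X) :
    0 < orbitCount σ :=
  have : Nonempty (Quotient (Equiv.Perm.SameCycle.setoid σ)) := ⟨⟦Classical.arbitrary X⟧⟩
  Nat.card_pos

theorem orbitCount_le {p : ℕ} (σ : Equiv.Perm (Fin p)) : orbitCount σ ≤ p := by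
  have := Nat.card_le_card_of_surjective (Quotient.mk (Equiv.Perm.SameCycle.setoid σ))
    Quotient.mk_surjective
  rwa [Nat.card_eq_fintype_card (α := Fin p), Fintype.card_fin] at this

theorem orbitCount_eq_iff {p : ℕ} (σ : Equiv.Perm (Fin p)) : orbitCount σ = p ↔ σ = 1 := by
  constructor
  · intro h
    have hinj : Function.Injective (Quotient.mk (Equiv.Perm.SameCycle.setoid σ)) :=
      ((Nat.bijective_iff_surjective_and_card _).2 ⟨Quotient.mk_surjective, by
        rw [Nat.card_eq_fintype_card (α := Fin p), Fintype.card_fin]; exact h.symm⟩).1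
    ext1 i
    exact hinj (Quotient.sound
      (Equiv.Perm.sameCycle_apply_left.2 (Equiv.Perm.SameCycle.refl σ i)))
  · rintro rfl
    refine (orbitCount_le 1).antisymm ?_
    have hinj : Function.Injective
        (Quotient.mk (Equiv.Perm.SameCycle.setoid (1 : Equiv.Perm (Fin p)))) := fun i j h =>
      Equiv.Perm.sameCycle_one.1 (Quotient.exact h)
    have := Nat.card_le_card_of_injective _ hinj
    rwa [Nat.card_eq_fintype_card (α := Fin p), Fintype.card_fin] at this

theorem tendsto_pow_div_pow {u : ℕ → ℝ} (hu : Tendsto u atTop atTop) {a p : ℕ} (hap : a ≤ p) :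
    Tendsto (fun n => u n ^ a / u n ^ p) atTop (𝓝 (if a = p then 1 else 0)) := by
  split_ifs with h
  · subst h
    refine tendsto_const_nhds.congr' ?_
    filter_upwards [hu.eventually_gt_atTop 0] with n hn
    exact (div_self (pow_pos hn _).ne').symm
  · exact (tendsto_pow_div_pow_atTop_zero (lt_of_le_of_ne hap h)).comp hu

/-- Only the identity has `p` orbits; all other terms are of lower order. -/
theorem tendsto_sum_pow_orbitCount_div {u : ℕ → ℝ} (hu : Tendsto u atTop atTop) (p : ℕ) :
    Tendsto (fun n => (∑ σ : Equiv.Perm (Fin p), u n ^ orbitCount σ) / u n ^ p) atTop (𝓝 1) := by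
  have h := tendsto_finsetSum Finset.univ fun (σ : Equiv.Perm (Fin p)) _ =>
    tendsto_pow_div_pow hu (orbitCount_le σ)
  simp_rw [orbitCount_eq_iff, Finset.sum_ite_eq' Finset.univ (1 : Equiv.Perm (Fin p)),
    Finset.mem_univ, if_true] at h
  simpa only [Finset.sum_div] using h

theorem theorem4p3 (l : ℕ) (hl : 1 ≤ l) (m : ℕ → ℕ)
    (hm : Tendsto (fun n : ℕ => (m n : ℝ) / (n : ℝ)) atTop (𝓝 1)) (q : ℕ) (hq : 1 ≤ q) :
    (∀ n : ℕ, Integrable (empiricalMoment l (m n) n (2 * q)) (uniformUnitVector l (m n) n)) ∧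
      Tendsto
        (fun n : ℕ => ∫ v, empiricalMoment l (m n) n (2 * q) v ∂(uniformUnitVector l (m n) n))
        atTop (𝓝 ((meanderPolynomial q).eval (l : ℝ))) := by
  refine ⟨fun n => integrable_empiricalMoment l (m n) n (2 * q), ?_⟩
  have : Nonempty (Fin (2 * q)) := ⟨⟨0, by omega⟩⟩
  have hn : Tendsto (fun n : ℕ => (n : ℝ)) atTop atTop := tendsto_natCast_atTop_atTop
  have hm' : Tendsto (fun n : ℕ => (m n : ℝ)) atTop atTop := by
    refine (hm.pos_mul_atTop one_pos hn).congr' ?_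
    filter_upwards [eventually_ge_atTop 1] with n hn
    have : (n : ℝ) ≠ 0 := by positivity
    field_simp
  have hN : Tendsto (fun n : ℕ => (l : ℝ) * (m n * n)) atTop atTop :=
    (hm'.atTop_mul_atTop₀ hn).const_mul_atTop (by positivity)
  have hZ := (tendsto_sum_pow_orbitCount_div hN (2 * q)).inv₀ one_ne_zero
  rw [inv_one] at hZ
  -- The exact formula regrouped: `(lm)^(2q) / (lmn)^(2q)` leaves `n^(-2q)`, the prefactor `1/(mn)`
  -- lowers both exponents by 1, and `m` is written as `(m/n) * n`.
  have hlim : Tendsto (fun n : ℕ => ∑ σ : Equiv.Perm (Fin (2 * q)), (l : ℝ) ^ orbitCount σ *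
      ((((∑ σ : Equiv.Perm (Fin (2 * q)), ((l : ℝ) * (m n * n)) ^ orbitCount σ) /
        ((l : ℝ) * (m n * n)) ^ (2 * q))⁻¹ *
        ((m n : ℝ) / n) ^ (orbitCount (finRotate (2 * q) * σ) - 1)) *
        ((n : ℝ) ^ ((orbitCount (finRotate (2 * q) * σ) - 1) +
          (orbitCount ((finRotate (2 * q))⁻¹ * σ) - 1)) / (n : ℝ) ^ (2 * q)))) atTop
      (𝓝 ((meanderPolynomial q).eval (l : ℝ))) := by
    rw [← sum_eq_eval_meanderPolynomial hq]
    refine tendsto_finsetSum _ fun σ _ => ?_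
    -- Positivity makes the truncated subtractions exact, so the exponent is `2q` precisely when the
    -- orbit counts sum to `2q + 2`.
    have c1 := orbitCount_pos (finRotate (2 * q) * σ)
    have c2 := orbitCount_pos ((finRotate (2 * q))⁻¹ * σ)
    have c3 := (orbitCount_add_le_and_flipsParity hq σ).1
    have h := ((hZ.mul (hm.pow (orbitCount (finRotate (2 * q) * σ) - 1))).mul
      (tendsto_pow_div_pow hn (a := (orbitCount (finRotate (2 * q) * σ) - 1) +
        (orbitCount ((finRotate (2 * q))⁻¹ * σ) - 1)) (p := 2 * q) (by omega))).const_mul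
      ((l : ℝ) ^ orbitCount σ)
    convert! h using 2
    rw [one_pow, one_mul, one_mul, mul_ite, mul_one, mul_zero]
    refine if_congr ?_ rfl rfl
    omega
  refine hlim.congr' ?_
  filter_upwards [eventually_ge_atTop 1, hm'.eventually_gt_atTop 0] with n hn1 hmn
  have hmn' : m n ≠ 0 := by
    rw [← Nat.pos_iff_ne_zero]; exact_mod_cast hmn
  rw [integral_empiricalMoment (by omega) hmn' (by omega) (by omega)]
  have hZ0 : ∑ σ : Equiv.Perm (Fin (2 * q)), ((l : ℝ) * (m n * n)) ^ orbitCount σ ≠ 0 :=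
    (Finset.sum_pos (fun σ _ => by positivity) Finset.univ_nonempty).ne'
  generalize ∑ σ : Equiv.Perm (Fin (2 * q)), ((l : ℝ) * (m n * n)) ^ orbitCount σ = Z at hZ0 ⊢
  rw [Finset.sum_div, Finset.mul_sum, Finset.mul_sum]
  refine Finset.sum_congr rfl fun σ _ => ?_
  obtain ⟨a, ha⟩ := Nat.exists_eq_add_of_lt (orbitCount_pos (finRotate (2 * q) * σ))
  obtain ⟨b, hb⟩ := Nat.exists_eq_add_of_lt (orbitCount_pos ((finRotate (2 * q))⁻¹ * σ))
  rw [ha, hb]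
  simp only [zero_add, Nat.add_sub_cancel]
  have hn0 : (n : ℝ) ≠ 0 := by positivity
  have hl0 : (l : ℝ) ≠ 0 := by positivity
  rw [inv_div, div_pow, mul_pow, mul_pow, mul_pow, pow_add]
  field_simp
  ring
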